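/- Consider the class of equations $$u_t+f(t)u_x+g(t)uu_x+h(t)u_{xxt}=0,\qquad gh\neq0,\tag{1}$$ where $f,g,h$ are smooth functions on a nonempty open interval $I$. The maximal Lie invariance algebra $A^{\max}$ of such an equation is the set of the smooth vector fields $\tau\partial_t+\xi\partial_x+\eta\partial_u$ on $I\times\mathbb R\times\mathbb R$, with components depending on $(t,x,u)$, whose third prolongation, applied to the left-hand side of the equation, vanishes on the set of the third-order jets that satisfy the equation. The group $G^\sim_1$ consists of the transformations $$\tilde t=T(t),\quad \tilde x=\delta_1x+\delta_2,\quad \tilde u=\delta_3u+\delta_4,\quad \tilde f=\frac{\delta_1}{T_t\delta_3}(\delta_3f-\delta_4g),\quad \tilde g=\frac{\delta_1}{T_t\delta_3}g,\quad \tilde h=\delta_1^2h,$$ where $\delta_1,\dots,\delta_4$ are constants with $\delta_1\delta_3\neq0$ and $T$ is a smooth function on $I$ with $T_t\neq0$; the new interval is $T(I)$. The kernel of the maximal Lie invariance algebras (for each interval $I$, the common part of the algebras of all equations over $I$) is $\langle\partial_x\rangle$ (Case 0 of both lists). An equation is said to have a Lie symmetry extension if $A^{\max}\neq\langle\partial_x\rangle$.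 **List up to $G^\sim_1$-equivalence.** Every equation of class (1) is $G^\sim_1$-equivalent to one with $g=1$. An equation of class (1) has a Lie symmetry extension if and only if it is $G^\sim_1$-equivalent to an equation with $g=1$ of one of the following cases, for which $A^{\max}$ has the basis given. 1. $h=\varepsilon t^\rho$, $f=\lambda t^{\frac{\rho-2}2}$, $t>0$: $\partial_x,\ 2t\partial_t+\rho x\partial_x+(\rho-2)u\partial_u$; 2. $h=\varepsilon t^2$, $f=\ln t$, $t>0$: $\partial_x,\ t\partial_t+x\partial_x-\partial_u$; 3. $h=\varepsilon e^t$, $f=\lambda e^{\frac12t}$: $\partial_x,\ 2\partial_t+x\partial_x+u\partial_u$; 4. $h=\varepsilon$, $f=t$: $\partial_x,\ \partial_t-\partial_u$; 5. $h=\varepsilon$, $f=0$: $\partial_x,\ \partial_t,\ t\partial_t-u\partial_u$. Here $\rho$ and $\lambda$ are arbitrary constants, with $(\rho,\lambda)\neq(0,0)$ in Case 1; $\varepsilon=\pm1$ in Cases 1, 3, 4, 5, and $\varepsilon$ is an arbitrary nonzero constant in Case 2. Equations that belong to different cases, or that have different values of $\varepsilon$, are not $G^\sim_1$-equivalent. **List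 without equivalence.** For an equation of class (1) let $T=\int g\,dt$ be any fixed antiderivative of $g$ on $I$. The equation has a Lie symmetry extension if and only if $h$ and $f$ are of one of the following forms, and then $A^{\max}$ has the basis given. 1. $h=\mu_1|\varepsilon T+\kappa|^\rho$, $f=\mu_2g|\varepsilon T+\kappa|^{\frac{\rho-2}2}+\mu_3g$: $\partial_x,\ \frac2g(\varepsilon T+\kappa)\partial_t+\varepsilon\rho x\partial_x+\varepsilon(\rho-2)(u+\mu_3)\partial_u$; 2. $h=\mu_1(\varepsilon T+\kappa)^2$, $f=\mu_2g\ln|\varepsilon T+\kappa|+\mu_3g$: $\partial_x,\ \frac1g(\varepsilon T+\kappa)\partial_t+\varepsilon x\partial_x-\varepsilon\mu_2\partial_u$; 3. $h=\mu_1e^{\sigma T}$, $f=\mu_2ge^{\frac12\sigma T}+\mu_3g$: $\partial_x,\ \frac2g\partial_t+\sigma x\partial_x+\sigma(u+\mu_3)\partial_u$; 4. $h=\mu_1$, $f=\mu_2gT+\mu_3g$: $\partial_x,\ \frac1g\partial_t-\mu_2\partial_u$; 5. $h=\mu_1$, $f=\mu_3g$: $\partial_x,\ \frac1g\partial_t,\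 \frac Tg\partial_t-(u+\mu_3)\partial_u$. Here $\varepsilon=\pm1$ and $\kappa,\rho,\sigma,\mu_1,\mu_2,\mu_3$ are constants with $\mu_1\neq0$; $\varepsilon T+\kappa\neq0$ on $I$ in Cases 1 and 2; $(\rho,\mu_2)\neq(0,0)$ in Case 1; $\sigma\neq0$ in Case 3; and $\mu_2\neq0$ in Case 4. -/

import Mathlib

open scoped ContDiff

namespace BBM

/-- An equation `u_t + f(t) u_x + g(t) u u_x + h(t) u_{xxt} = 0` whose coefficients are smooth on a
nonempty open interval `I`, with `g h ≠ 0` on `I`. Values of `f`, `g`, `h` outside `I` are never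
used. -/
structure Equation where
  /-- the interval on which `t` varies -/
  I : Set ℝ
  f : ℝ → ℝ
  g : ℝ → ℝ
  h : ℝ → ℝ
  isOpen_I : IsOpen I
  ordConnected_I : I.OrdConnected
  nonempty_I : I.Nonempty
  smooth_f : ContDiffOn ℝ ∞ f I
  smooth_g : ContDiffOn ℝ ∞ g I
  smooth_h : ContDiffOn ℝ ∞ h I
  g_ne_zero : ∀ t ∈ I, g t ≠ 0
  h_ne_zero : ∀ t ∈ I, h t ≠ 0

/-- A vector field `τ(t,x,u) ∂_t + ξ(t,x,u) ∂_x + η(t,x,u) ∂_u` on the space of `(t, x, u)`, given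
by its components `(τ, ξ, η)`. -/
abbrev VectorField : Type := ℝ × ℝ × ℝ → ℝ × ℝ × ℝ

/-- The domain `I × ℝ × ℝ` of the variables `(t, x, u)`. -/
def Equation.domain (E : Equation) : Set (ℝ × ℝ × ℝ) := {p | p.1 ∈ E.I}

/-! ### Lie symmetries -/

/-- The partial derivative in `t`. -/
noncomputable def dt (φ : ℝ → ℝ → ℝ) : ℝ → ℝ → ℝ := fun t x => deriv (fun s => φ s x) t

/-- The partial derivative in `x`. -/
noncomputable def dx (φ : ℝ → ℝ → ℝ) : ℝ → ℝ → ℝ := fun t x => deriv (fun y => φ t y) x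

/-- The component `τ` of a vector field along the graph `u = φ(t,x)`. -/
def tauOn (v : VectorField) (φ : ℝ → ℝ → ℝ) : ℝ → ℝ → ℝ := fun t x => (v (t, x, φ t x)).1

/-- The component `ξ` of a vector field along the graph `u = φ(t,x)`. -/
def xiOn (v : VectorField) (φ : ℝ → ℝ → ℝ) : ℝ → ℝ → ℝ := fun t x => (v (t, x, φ t x)).2.1

/-- The component `η` of a vector field along the graph `u = φ(t,x)`. -/
def etaOn (v : VectorField) (φ : ℝ → ℝ → ℝ) : ℝ → ℝ → ℝ := fun t x => (v (t, x, φ t x)).2.2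

/-- The characteristic `Q = η - τ u_t - ξ u_x` of a vector field, evaluated on `u = φ(t,x)`. -/
noncomputable def charOn (v : VectorField) (φ : ℝ → ℝ → ℝ) : ℝ → ℝ → ℝ := fun t x =>
  etaOn v φ t x - tauOn v φ t x * dt φ t x - xiOn v φ t x * dx φ t x

/-- The coefficient `η^t = D_t Q + τ u_tt + ξ u_tx` of the prolongation, evaluated on `u = φ(t,x)`.
A total derivative evaluated on `u = φ(t,x)` is a partial derivative of the evaluation. -/
noncomputable def etaT (v : VectorField) (φ : ℝ → ℝ → ℝ) : ℝ → ℝ → ℝ := fun t x =>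
  dt (charOn v φ) t x + tauOn v φ t x * dt (dt φ) t x + xiOn v φ t x * dx (dt φ) t x

/-- The coefficient `η^x = D_x Q + τ u_tx + ξ u_xx` of the prolongation. -/
noncomputable def etaX (v : VectorField) (φ : ℝ → ℝ → ℝ) : ℝ → ℝ → ℝ := fun t x =>
  dx (charOn v φ) t x + tauOn v φ t x * dt (dx φ) t x + xiOn v φ t x * dx (dx φ) t x

/-- The coefficient `η^{xxt} = D_t D_x D_x Q + τ u_{xxtt} + ξ u_{xxxt}` of the prolongation (the
derivatives of order four cancel). -/
noncomputable def etaXXT (v : VectorField) (φ : ℝ → ℝ → ℝ) : ℝ → ℝ → ℝ := fun t x =>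
  dt (dx (dx (charOn v φ))) t x + tauOn v φ t x * dt (dt (dx (dx φ))) t x
    + xiOn v φ t x * dx (dt (dx (dx φ))) t x

/-- The left-hand side `u_t + f u_x + g u u_x + h u_{xxt}` as a function on the jet space. It does
not depend on `x` and on the remaining derivatives. -/
def Equation.lhs (E : Equation) (t u ut ux uxxt : ℝ) : ℝ :=
  ut + E.f t * ux + E.g t * u * ux + E.h t * uxxt

/-- The infinitesimal invariance criterion: the third prolongation of the smooth vector field `v`,
applied to the left-hand side (that is, the derivative of the left-hand side in the direction of the
prolonged field), vanishes at every point of the third-order jet space that satisfies the equation.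
The points of the jet space are the jets of smooth functions `φ` at points `(t,x)`, `t ∈ I`. -/
def IsLieSymmetry (E : Equation) (v : VectorField) : Prop :=
  ContDiffOn ℝ ∞ v E.domain ∧
  ∀ φ : ℝ → ℝ → ℝ, ContDiff ℝ ∞ (fun p : ℝ × ℝ => φ p.1 p.2) →
    ∀ t ∈ E.I, ∀ x : ℝ,
      E.lhs t (φ t x) (dt φ t x) (dx φ t x) (dt (dx (dx φ)) t x) = 0 →
      deriv (fun s : ℝ => E.lhs (t + s * tauOn v φ t x) (φ t x + s * etaOn v φ t x)
        (dt φ t x + s * etaT v φ t x) (dx φ t x + s * etaX v φ t x)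
        (dt (dx (dx φ)) t x + s * etaXXT v φ t x)) 0 = 0

/-- The vector fields in the list `b` form a basis of the maximal Lie invariance algebra of `E`, the
space of all Lie symmetries on `I × ℝ × ℝ`: the symmetries are exactly the linear combinations of
`b`, and `b` is linearly independent. Vector fields are compared on `I × ℝ × ℝ` only. -/
def IsBasisOfMaxAlgebra (E : Equation) (b : List VectorField) : Prop :=
  (∀ v : VectorField, IsLieSymmetry E v ↔
    ∃ c : Fin b.length → ℝ, Set.EqOn v (∑ i, c i • b.get i) E.domain) ∧
  ∀ c : Fin b.length → ℝ, Set.EqOn (∑ i, c i • b.get i) 0 E.domain → c = 0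

/-- The vector field `∂_x`. -/
def partialX : VectorField := fun _ => (0, 1, 0)

/-- The equation admits a proper extension of the algebra `⟨∂_x⟩`. -/
def HasExtension (E : Equation) : Prop := ¬ IsBasisOfMaxAlgebra E [partialX]

/-! ### The equivalence group -/

/-- An element of the equivalence group, restricted to `t ∈ I`: the point transformation
`t' = T(t)`, `x' = δ₁ x + δ₂`, `u' = δ₃ u + δ₄`, where `T` is smooth with `T_t ≠ 0` and
`δ₁ δ₃ ≠ 0`. -/
structure EquivTransformation (I : Set ℝ) where
  T : ℝ → ℝ
  δ₁ : ℝ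
  δ₂ : ℝ
  δ₃ : ℝ
  δ₄ : ℝ
  smooth_T : ContDiffOn ℝ ∞ T I
  deriv_T_ne_zero : ∀ t ∈ I, deriv T t ≠ 0
  δ_ne_zero : δ₁ * δ₃ ≠ 0

/-- The transformation maps `E` to `E'`: it maps the interval of `E` onto the one of `E'`, and
`f' = δ₁ (δ₃ f - δ₄ g) / (T_t δ₃)`, `g' = δ₁ g / (T_t δ₃)`, `h' = δ₁² h`. The translation `δ₂` of
`x` does not act on the coefficients. -/
def EquivTransformation.Maps {E : Equation} (Φ : EquivTransformation E.I) (E' : Equation) : Prop :=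
  Φ.T '' E.I = E'.I ∧ ∀ t ∈ E.I,
    E'.f (Φ.T t) = Φ.δ₁ / (deriv Φ.T t * Φ.δ₃) * (Φ.δ₃ * E.f t - Φ.δ₄ * E.g t) ∧
    E'.g (Φ.T t) = Φ.δ₁ / (deriv Φ.T t * Φ.δ₃) * E.g t ∧
    E'.h (Φ.T t) = Φ.δ₁ ^ 2 * E.h t

/-- Equivalence of equations with respect to the equivalence group of the class. -/
def GEquiv (E E' : Equation) : Prop := ∃ Φ : EquivTransformation E.I, Φ.Maps E'

/-! ### The list up to equivalence -/

/-- The cases of Lie symmetry extensions up to equivalence, with their parameters. -/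
inductive Row1 : Type
  | case1 (ε ρ l : ℝ)
  | case2 (ε : ℝ)
  | case3 (ε l : ℝ)
  | case4 (ε : ℝ)
  | case5 (ε : ℝ)

namespace Row1

/-- The number of the case. -/
def number : Row1 → ℕ
  | case1 _ _ _ => 1
  | case2 _ => 2
  | case3 _ _ => 3
  | case4 _ => 4
  | case5 _ => 5

/-- The parameter `ε`. -/
def eps : Row1 → ℝ
  | case1 ε _ _ => ε
  | case2 ε => ε
  | case3 ε _ => ε
  | case4 ε => ε
  | case5 ε => ε

/-- The constraints on the parameters. -/
def Admissible : Row1 → Prop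
  | case1 ε ρ l => (ε = 1 ∨ ε = -1) ∧ (ρ, l) ≠ (0, 0)
  | case2 ε => ε ≠ 0
  | case3 ε _ => ε = 1 ∨ ε = -1
  | case4 ε => ε = 1 ∨ ε = -1
  | case5 ε => ε = 1 ∨ ε = -1

/-- The values of `t` for which the coefficients are defined: `t > 0` in the cases that involve
powers of `t` or `ln t`. -/
def range : Row1 → Set ℝ
  | case1 _ _ _ => Set.Ioi 0
  | case2 _ => Set.Ioi 0
  | case3 _ _ => Set.univ
  | case4 _ => Set.univ
  | case5 _ => Set.univ

noncomputable def h : Row1 → ℝ → ℝ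
  | case1 ε ρ _ => fun t => ε * t ^ ρ
  | case2 ε => fun t => ε * t ^ 2
  | case3 ε _ => fun t => ε * Real.exp t
  | case4 ε => fun _ => ε
  | case5 ε => fun _ => ε

noncomputable def f : Row1 → ℝ → ℝ
  | case1 _ ρ l => fun t => l * t ^ ((ρ - 2) / 2)
  | case2 _ => fun t => Real.log t
  | case3 _ l => fun t => l * Real.exp (t / 2)
  | case4 _ => fun t => t
  | case5 _ => fun _ => 0

/-- The basis of the maximal Lie invariance algebra. -/
def basis : Row1 → List VectorField
  | case1 _ ρ _ => [partialX, fun p => (2 * p.1, ρ * p.2.1, (ρ - 2) * p.2.2)]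
  | case2 _ => [partialX, fun p => (p.1, p.2.1, -1)]
  | case3 _ _ => [partialX, fun p => (2, p.2.1, p.2.2)]
  | case4 _ => [partialX, fun _ => (1, 0, -1)]
  | case5 _ => [partialX, fun _ => (1, 0, 0), fun p => (p.1, 0, -p.2.2)]

/-- The equation `E` is the one of the row, with `g = 1`. -/
def Describes (r : Row1) (E : Equation) : Prop :=
  r.Admissible ∧ E.I ⊆ r.range ∧ ∀ t ∈ E.I, E.f t = r.f t ∧ E.g t = 1 ∧ E.h t = r.h t

end Row1

/-! ### The list without equivalence -/

/-- The cases of Lie symmetry extensions without the use of equivalence, with their parameters. -/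
inductive Row2 : Type
  | case1 (ε κ ρ μ₁ μ₂ μ₃ : ℝ)
  | case2 (ε κ μ₁ μ₂ μ₃ : ℝ)
  | case3 (σ μ₁ μ₂ μ₃ : ℝ)
  | case4 (μ₁ μ₂ μ₃ : ℝ)
  | case5 (μ₁ μ₃ : ℝ)

namespace Row2

/-- The constraints on the parameters. -/
def Admissible : Row2 → Prop
  | case1 ε _ ρ μ₁ μ₂ _ => (ε = 1 ∨ ε = -1) ∧ μ₁ ≠ 0 ∧ (ρ, μ₂) ≠ (0, 0)
  | case2 ε _ μ₁ _ _ => (ε = 1 ∨ ε = -1) ∧ μ₁ ≠ 0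
  | case3 σ μ₁ _ _ => μ₁ ≠ 0 ∧ σ ≠ 0
  | case4 μ₁ μ₂ _ => μ₁ ≠ 0 ∧ μ₂ ≠ 0
  | case5 μ₁ _ => μ₁ ≠ 0

/-- The values of `T` for which the coefficients are defined. -/
def range : Row2 → Set ℝ
  | case1 ε κ _ _ _ _ => {T | ε * T + κ ≠ 0}
  | case2 ε κ _ _ _ => {T | ε * T + κ ≠ 0}
  | case3 _ _ _ _ => Set.univ
  | case4 _ _ _ => Set.univ
  | case5 _ _ => Set.univ

/-- The coefficient `h` in terms of the value `T` of the antiderivative of `g`. The expression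
`ε T + κ` may be negative and is replaced by its absolute value in powers and logarithms. -/
noncomputable def h : Row2 → ℝ → ℝ
  | case1 ε κ ρ μ₁ _ _ => fun T => μ₁ * |ε * T + κ| ^ ρ
  | case2 ε κ μ₁ _ _ => fun T => μ₁ * (ε * T + κ) ^ 2
  | case3 σ μ₁ _ _ => fun T => μ₁ * Real.exp (σ * T)
  | case4 μ₁ _ _ => fun _ => μ₁
  | case5 μ₁ _ => fun _ => μ₁

/-- The coefficient `f` in terms of the value `g` and the value `T` of its antiderivative. -/
noncomputable def f : Row2 → ℝ → ℝ → ℝ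
  | case1 ε κ ρ _ μ₂ μ₃ => fun g T => μ₂ * g * |ε * T + κ| ^ ((ρ - 2) / 2) + μ₃ * g
  | case2 ε κ _ μ₂ μ₃ => fun g T => μ₂ * g * Real.log |ε * T + κ| + μ₃ * g
  | case3 σ _ μ₂ μ₃ => fun g T => μ₂ * g * Real.exp (σ * T / 2) + μ₃ * g
  | case4 _ μ₂ μ₃ => fun g T => μ₂ * g * T + μ₃ * g
  | case5 _ μ₃ => fun g _ => μ₃ * g

/-- The basis of the maximal Lie invariance algebra. -/
noncomputable def basis (g T : ℝ → ℝ) : Row2 → List VectorField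
  | case1 ε κ ρ _ _ μ₃ => [partialX, fun p =>
      (2 / g p.1 * (ε * T p.1 + κ), ε * ρ * p.2.1, ε * (ρ - 2) * (p.2.2 + μ₃))]
  | case2 ε κ _ μ₂ _ => [partialX, fun p => (1 / g p.1 * (ε * T p.1 + κ), ε * p.2.1, -(ε * μ₂))]
  | case3 σ _ _ μ₃ => [partialX, fun p => (2 / g p.1, σ * p.2.1, σ * (p.2.2 + μ₃))]
  | case4 _ μ₂ _ => [partialX, fun p => (1 / g p.1, 0, -μ₂)]
  | case5 _ μ₃ => [partialX, fun p => (1 / g p.1, 0, 0), fun p => (T p.1 / g p.1, 0, -(p.2.2 + μ₃))]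

/-- The equation `E` is the one of the row, where `T` is the fixed antiderivative of `g`. -/
def Describes (r : Row2) (E : Equation) (T : ℝ → ℝ) : Prop :=
  r.Admissible ∧ ∀ t ∈ E.I, T t ∈ r.range ∧ E.f t = r.f (E.g t) (T t) ∧ E.h t = r.h (T t)

end Row2

end BBM

/-! The prolonged field applied to the left-hand side is a polynomial in the derivatives of `u`, and
the equation can be solved for `u_xxt` because `h ≠ 0`. All other derivatives that occur are
therefore free, and explicit cubic polynomials realise the required jets (`exists_jet`). Comparing
coefficients gives `τ = τ(t)` and `ξ = ξ(x)` from `u_ttx` and `u_xxx`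
(`IsLieSymmetry.tau_xi_partials`), and then the remaining determining equations
(`IsLieSymmetry.determining`). They integrate to `ξ = a x + c`, `η = α u + b` together with `τ h' =
2 a h`, `(τ g)' = (a - α) g` and `(τ f)' = a f - b g`.

Let `T` be an antiderivative of `g` and let `w = f / g`. The middle condition says `τ g = θ` with `θ
= (a - α) T + k`, and the other two become the linear conditions `θ h' = 2 a g h` and `θ w' = g (α w
- b)` (`isLieSymmetry_iff_classifying`). A solution `(a, α, b, k)` is determined by the pair `(a -
α, k)`. If these pairs span the plane, then `h` and `w` are constant (`flat_of_classifying`). So the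
algebra modulo `∂_x` has dimension at most one, unless `h` and `w` are constant, when it has
dimension two. This gives the bases.

For exhaustiveness one nonzero pair is fixed and the two linear equations are solved. If `a = α`,
the solutions are exponential or affine in `T`. If `a ≠ α` and `θ` has no zero, they are powers or
logarithms of `θ`. If `θ` vanishes somewhere on the interval, smoothness forces `h` and `w` to be
constant. This is the list without equivalence; taking an affine function of `T` as the new time and
rescaling `x` and `u` turns it into the list up to equivalence.

For inequivalence, a transformation between equations with `g = 1` carries the generator modulo
`∂_x` of one to a multiple of that of the other, and it preserves constancy of `h` and `w`.
Comparing generators separates the cases. The sign of `h` is invariant, which fixes `ε = ±1`; in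
Case 2 the transformation is so restricted that `ε` itself is invariant. The kernel is found from a
single equation whose only symmetries are the multiples of `∂_x` (`rigidEquation`). -/

namespace BBM

/-! ### Directional derivatives -/

section Directional

variable {V : Type*} [NormedAddCommGroup V] [NormedSpace ℝ V]

/-- The derivative of `W` in the direction `e`. -/
noncomputable def pd (e : V) (W : V → ℝ) : V → ℝ := fun p => fderiv ℝ W p e

variable {U : Set V} {W W' : V → ℝ}

theorem contDiffOn_pd (hU : IsOpen U) (hW : ContDiffOn ℝ ∞ W U) (e : V) :
    ContDiffOn ℝ ∞ (pd e W) U :=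
  (hW.fderiv_of_isOpen (m := ∞) hU (by simp)).clm_apply contDiffOn_const

theorem pd_congr (hU : IsOpen U) (h : Set.EqOn W W' U) (e : V) :
    Set.EqOn (pd e W) (pd e W') U := by
  intro p hp
  have : W =ᶠ[nhds p] W' := Filter.eventuallyEq_of_mem (hU.mem_nhds hp) h
  simp [pd, this.fderiv_eq]

theorem pd_eq_zero (hU : IsOpen U) (h : ∀ p ∈ U, W p = 0) (e : V) :
    ∀ p ∈ U, pd e W p = 0 := by
  intro p hp
  rw [pd_congr (W' := fun _ => 0) hU h e hp]
  simp [pd]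

theorem differentiableAt_of_contDiffOn (hU : IsOpen U) (hW : ContDiffOn ℝ ∞ W U) {p : V}
    (hp : p ∈ U) : DifferentiableAt ℝ W p :=
  (hW.contDiffAt (hU.mem_nhds hp)).differentiableAt (by simp)

theorem pd_comm (hU : IsOpen U) (hW : ContDiffOn ℝ ∞ W U) (a b : V) {p : V} (hp : p ∈ U) :
    pd a (pd b W) p = pd b (pd a W) p := by
  have hd : DifferentiableAt ℝ (fderiv ℝ W) p :=
    ((hW.fderiv_of_isOpen (m := ∞) hU (by simp)).contDiffAt (hU.mem_nhds hp)).differentiableAt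
      (by simp)
  have key : ∀ a b : V, pd a (pd b W) p = fderiv ℝ (fderiv ℝ W) p a b := by
    intro a b
    have : fderiv ℝ (pd b W) p = _ := (hd.hasFDerivAt.clm_apply (hasFDerivAt_const b p)).fderiv
    rw [pd, this]
    simp
  have hs : IsSymmSndFDerivAt ℝ W p :=
    (hW.contDiffAt (hU.mem_nhds hp)).isSymmSndFDerivAt
      (by simpa using (WithTop.coe_le_coe.2 (le_top : (2 : ℕ∞) ≤ ⊤)))
  rw [key, key, hs.eq]

theorem eqOn_const_of_fderiv_zero (hU : IsOpen U) (hc : IsPreconnected U)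
    (hW : ContDiffOn ℝ ∞ W U) (h : ∀ p ∈ U, fderiv ℝ W p = 0) : ∃ c, ∀ p ∈ U, W p = c :=
  hU.exists_is_const_of_fderiv_eq_zero hc (hW.differentiableOn (by simp)) h

end Directional

/-! ### Derivatives of functions of `(t, x)` -/

section Partial

variable {I : Set ℝ} {a b a' b' : ℝ → ℝ → ℝ}

/-- The function `a'` is the partial derivative of `a` in `t` on `I × ℝ`. -/
def HasDt (I : Set ℝ) (a a' : ℝ → ℝ → ℝ) : Prop :=
  ∀ t ∈ I, ∀ x, HasDerivAt (fun s => a s x) (a' t x) t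

/-- The function `a'` is the partial derivative of `a` in `x` on `I × ℝ`. -/
def HasDx (I : Set ℝ) (a a' : ℝ → ℝ → ℝ) : Prop :=
  ∀ t ∈ I, ∀ x, HasDerivAt (fun y => a t y) (a' t x) x

theorem HasDt.add (ha : HasDt I a a') (hb : HasDt I b b') :
    HasDt I (fun t x => a t x + b t x) (fun t x => a' t x + b' t x) :=
  fun t ht x => (ha t ht x).add (hb t ht x)

theorem HasDt.sub (ha : HasDt I a a') (hb : HasDt I b b') :
    HasDt I (fun t x => a t x - b t x) (fun t x => a' t x - b' t x) :=
  fun t ht x => (ha t ht x).sub (hb t ht x)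

theorem HasDt.mul (ha : HasDt I a a') (hb : HasDt I b b') :
    HasDt I (fun t x => a t x * b t x) (fun t x => a' t x * b t x + a t x * b' t x) :=
  fun t ht x => (ha t ht x).mul (hb t ht x)

theorem HasDx.add (ha : HasDx I a a') (hb : HasDx I b b') :
    HasDx I (fun t x => a t x + b t x) (fun t x => a' t x + b' t x) :=
  fun t ht x => (ha t ht x).add (hb t ht x)

theorem HasDx.sub (ha : HasDx I a a') (hb : HasDx I b b') :
    HasDx I (fun t x => a t x - b t x) (fun t x => a' t x - b' t x) :=
  fun t ht x => (ha t ht x).sub (hb t ht x)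

theorem HasDx.mul (ha : HasDx I a a') (hb : HasDx I b b') :
    HasDx I (fun t x => a t x * b t x) (fun t x => a' t x * b t x + a t x * b' t x) :=
  fun t ht x => (ha t ht x).mul (hb t ht x)

theorem HasDt.dt_eq (ha : HasDt I a a') {t : ℝ} (ht : t ∈ I) (x : ℝ) : dt a t x = a' t x :=
  (ha t ht x).deriv

theorem HasDx.dx_eq (ha : HasDx I a a') {t : ℝ} (ht : t ∈ I) (x : ℝ) : dx a t x = a' t x :=
  (ha t ht x).deriv

theorem HasDx.congr (ha : HasDx I a a') (h : ∀ t ∈ I, ∀ x, b t x = a t x) : HasDx I b a' := by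
  intro t ht x
  have : (fun y => b t y) = fun y => a t y := funext fun y => h t ht y
  rw [this]
  exact ha t ht x

theorem HasDt.congr (hI : IsOpen I) (ha : HasDt I a a') (h : ∀ t ∈ I, ∀ x, b t x = a t x) :
    HasDt I b a' := by
  intro t ht x
  refine (ha t ht x).congr_of_eventuallyEq ?_
  filter_upwards [hI.mem_nhds ht] with s hs using h s hs x

/-- The formulas for the derivatives in `x` are known only over `I`; openness of `I` allows them to
be differentiated in `t`. -/
theorem dt_dx_dx_eq (hI : IsOpen I) {c d e : ℝ → ℝ → ℝ} (h1 : HasDx I a c) (h2 : HasDx I c d)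
    (h3 : HasDt I d e) {t : ℝ} (ht : t ∈ I) (x : ℝ) : dt (dx (dx a)) t x = e t x :=
  (h3.congr hI fun _ hs y => (h2.congr fun _ hr z => h1.dx_eq hr z).dx_eq hs y).dt_eq ht x

end Partial

/-! ### Smooth functions of two variables and their mixed partial derivatives. -/

section SmoothPair

variable {φ : ℝ → ℝ → ℝ}

/-- Smoothness of a function of two variables. -/
abbrev Smooth₂ (φ : ℝ → ℝ → ℝ) : Prop := ContDiff ℝ ∞ (fun p : ℝ × ℝ => φ p.1 p.2)

theorem Smooth₂.hasDerivAt_fst (h : Smooth₂ φ) (t x : ℝ) :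
    HasDerivAt (fun s => φ s x) (pd (1, 0) (fun p : ℝ × ℝ => φ p.1 p.2) (t, x)) t := by
  have h1 : HasFDerivAt (fun p : ℝ × ℝ => φ p.1 p.2) _ (t, x) :=
    (h.differentiable (by simp) (t, x)).hasFDerivAt
  exact h1.comp_hasDerivAt t ((hasDerivAt_id t).prodMk (hasDerivAt_const t x))

theorem Smooth₂.hasDerivAt_snd (h : Smooth₂ φ) (t x : ℝ) :
    HasDerivAt (fun y => φ t y) (pd (0, 1) (fun p : ℝ × ℝ => φ p.1 p.2) (t, x)) x := by
  have h1 : HasFDerivAt (fun p : ℝ × ℝ => φ p.1 p.2) _ (t, x) :=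
    (h.differentiable (by simp) (t, x)).hasFDerivAt
  exact h1.comp_hasDerivAt x ((hasDerivAt_const x t).prodMk (hasDerivAt_id x))

theorem Smooth₂.dt_eq (h : Smooth₂ φ) :
    dt φ = fun t x => pd (1, 0) (fun p : ℝ × ℝ => φ p.1 p.2) (t, x) :=
  funext fun t => funext fun x => (h.hasDerivAt_fst t x).deriv

theorem Smooth₂.dx_eq (h : Smooth₂ φ) :
    dx φ = fun t x => pd (0, 1) (fun p : ℝ × ℝ => φ p.1 p.2) (t, x) :=
  funext fun t => funext fun x => (h.hasDerivAt_snd t x).deriv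

theorem Smooth₂.dt (h : Smooth₂ φ) : Smooth₂ (dt φ) := by
  rw [h.dt_eq]
  exact contDiffOn_univ.1 (contDiffOn_pd isOpen_univ h.contDiffOn _)

theorem Smooth₂.dx (h : Smooth₂ φ) : Smooth₂ (dx φ) := by
  rw [h.dx_eq]
  exact contDiffOn_univ.1 (contDiffOn_pd isOpen_univ h.contDiffOn _)

theorem Smooth₂.hasDt (h : Smooth₂ φ) (I : Set ℝ) : HasDt I φ (BBM.dt φ) :=
  fun t _ x => (h.hasDerivAt_fst t x).differentiableAt.hasDerivAt

theorem Smooth₂.hasDx (h : Smooth₂ φ) (I : Set ℝ) : HasDx I φ (BBM.dx φ) :=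
  fun t _ x => (h.hasDerivAt_snd t x).differentiableAt.hasDerivAt

theorem Smooth₂.dx_dt (h : Smooth₂ φ) : BBM.dx (BBM.dt φ) = BBM.dt (BBM.dx φ) := by
  rw [h.dt.dx_eq, h.dx.dt_eq]
  simp only [h.dt_eq, h.dx_eq]
  funext t x
  exact pd_comm isOpen_univ h.contDiffOn _ _ (Set.mem_univ _)

end SmoothPair

/-! ### Total derivatives -/

section Total

variable {I : Set ℝ} {W : ℝ × ℝ × ℝ → ℝ} {φ : ℝ → ℝ → ℝ}

/-- The derivative in the first variable `t` of a function of `(t, x, u)`. -/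
notation "pT" => pd ((1, 0, 0) : ℝ × ℝ × ℝ)

/-- The derivative in the second variable `x` of a function of `(t, x, u)`. -/
notation "pX" => pd ((0, 1, 0) : ℝ × ℝ × ℝ)

/-- The derivative in the third variable `u` of a function of `(t, x, u)`. -/
notation "pU" => pd ((0, 0, 1) : ℝ × ℝ × ℝ)

/-- The set `I × ℝ × ℝ`. -/
abbrev dom (I : Set ℝ) : Set (ℝ × ℝ × ℝ) := {p | p.1 ∈ I}

theorem isOpen_dom (hI : IsOpen I) : IsOpen (dom I) := hI.preimage continuous_fst

/-- The total derivative `D_t W` evaluated on `u = φ(t,x)`. -/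
noncomputable def totT (W : ℝ × ℝ × ℝ → ℝ) (φ : ℝ → ℝ → ℝ) : ℝ → ℝ → ℝ := fun t x =>
  pT W (t, x, φ t x) + pU W (t, x, φ t x) * dt φ t x

/-- The total derivative `D_x W` evaluated on `u = φ(t,x)`. -/
noncomputable def totX (W : ℝ × ℝ × ℝ → ℝ) (φ : ℝ → ℝ → ℝ) : ℝ → ℝ → ℝ := fun t x =>
  pX W (t, x, φ t x) + pU W (t, x, φ t x) * dx φ t x

/-- The total derivative `D_x D_x W` evaluated on `u = φ(t,x)`. -/
noncomputable def totXX (W : ℝ × ℝ × ℝ → ℝ) (φ : ℝ → ℝ → ℝ) : ℝ → ℝ → ℝ := fun t x =>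
  totX (pX W) φ t x + (totX (pU W) φ t x * dx φ t x + pU W (t, x, φ t x) * dx (dx φ) t x)

/-- The total derivative `D_t D_x W` evaluated on `u = φ(t,x)`. -/
noncomputable def totXT (W : ℝ × ℝ × ℝ → ℝ) (φ : ℝ → ℝ → ℝ) : ℝ → ℝ → ℝ := fun t x =>
  totT (pX W) φ t x + (totT (pU W) φ t x * dx φ t x + pU W (t, x, φ t x) * dt (dx φ) t x)

/-- The total derivative `D_t D_x D_x W` evaluated on `u = φ(t,x)`. -/
noncomputable def totXXT (W : ℝ × ℝ × ℝ → ℝ) (φ : ℝ → ℝ → ℝ) : ℝ → ℝ → ℝ := fun t x =>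
  totXT (pX W) φ t x + ((totXT (pU W) φ t x * dx φ t x + totX (pU W) φ t x * dt (dx φ) t x)
    + (totT (pU W) φ t x * dx (dx φ) t x + pU W (t, x, φ t x) * dt (dx (dx φ)) t x))

theorem hasDt_comp (hI : IsOpen I) (hW : ContDiffOn ℝ ∞ W (dom I)) (hφ : Smooth₂ φ) :
    HasDt I (fun t x => W (t, x, φ t x)) (totT W φ) := by
  intro t ht x
  have h1 := (differentiableAt_of_contDiffOn (isOpen_dom hI) hW
    (p := (t, x, φ t x)) ht).hasFDerivAt
  have h2 := h1.comp_hasDerivAt t ((hasDerivAt_id t).prodMk ((hasDerivAt_const t x).prodMk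
    (hφ.hasDt I t ht x)))
  refine h2.congr_deriv ?_
  have : ((1 : ℝ), (0 : ℝ), dt φ t x) = (1, 0, 0) + dt φ t x • (0, 0, 1) := by ext <;> simp
  rw [this, map_add, map_smul, smul_eq_mul, totT, mul_comm]
  rfl

theorem hasDx_comp (hI : IsOpen I) (hW : ContDiffOn ℝ ∞ W (dom I)) (hφ : Smooth₂ φ) :
    HasDx I (fun t x => W (t, x, φ t x)) (totX W φ) := by
  intro t ht x
  have h1 := (differentiableAt_of_contDiffOn (isOpen_dom hI) hW
    (p := (t, x, φ t x)) ht).hasFDerivAt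
  have h2 := h1.comp_hasDerivAt x ((hasDerivAt_const x t).prodMk ((hasDerivAt_id x).prodMk
    (hφ.hasDx I t ht x)))
  refine h2.congr_deriv ?_
  have : ((0 : ℝ), (1 : ℝ), dx φ t x) = (0, 1, 0) + dx φ t x • (0, 0, 1) := by ext <;> simp
  rw [this, map_add, map_smul, smul_eq_mul, totX, mul_comm]
  rfl

theorem hasDx_totX (hI : IsOpen I) (hW : ContDiffOn ℝ ∞ W (dom I)) (hφ : Smooth₂ φ) :
    HasDx I (totX W φ) (totXX W φ) :=
  have h e := contDiffOn_pd (isOpen_dom hI) hW e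
  (hasDx_comp hI (h _) hφ).add ((hasDx_comp hI (h _) hφ).mul (hφ.dx.hasDx I))

theorem hasDt_totX (hI : IsOpen I) (hW : ContDiffOn ℝ ∞ W (dom I)) (hφ : Smooth₂ φ) :
    HasDt I (totX W φ) (totXT W φ) :=
  have h e := contDiffOn_pd (isOpen_dom hI) hW e
  (hasDt_comp hI (h _) hφ).add ((hasDt_comp hI (h _) hφ).mul (hφ.dx.hasDt I))

theorem hasDt_totXX (hI : IsOpen I) (hW : ContDiffOn ℝ ∞ W (dom I)) (hφ : Smooth₂ φ) :
    HasDt I (totXX W φ) (totXXT W φ) :=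
  have h e := contDiffOn_pd (isOpen_dom hI) hW e
  (hasDt_totX hI (h _) hφ).add (((hasDt_totX hI (h _) hφ).mul (hφ.dx.hasDt I)).add
    ((hasDt_comp hI (h _) hφ).mul (hφ.dx.dx.hasDt I)))

end Total

/-! ### The prolongation -/

section Prolongation

variable {I : Set ℝ} {v : VectorField} {φ : ℝ → ℝ → ℝ}

/-- The component `τ`. -/
abbrev VectorField.tau (v : VectorField) : ℝ × ℝ × ℝ → ℝ := fun p => (v p).1

/-- The component `ξ`. -/
abbrev VectorField.xi (v : VectorField) : ℝ × ℝ × ℝ → ℝ := fun p => (v p).2.1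

/-- The component `η`. -/
abbrev VectorField.eta (v : VectorField) : ℝ × ℝ × ℝ → ℝ := fun p => (v p).2.2

/-- By the product rule, `D_t Q` contains `-τ u_tt - ξ u_tx`, which the terms added in `etaT`
cancel. -/
theorem etaT_eq (hI : IsOpen I) (hv : ContDiffOn ℝ ∞ v (dom I)) (hφ : Smooth₂ φ) {t : ℝ}
    (ht : t ∈ I) (x : ℝ) : etaT v φ t x = totT v.eta φ t x - totT v.tau φ t x * dt φ t x
      - totT v.xi φ t x * dx φ t x := by
  have h1 := hasDt_comp hI hv.fst hφ
  have h2 := hasDt_comp hI hv.snd.fst hφ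
  have h3 := hasDt_comp hI hv.snd.snd hφ
  have h := ((h3.sub (h1.mul (hφ.dt.hasDt I))).sub (h2.mul (hφ.dx.hasDt I))).dt_eq ht x
  simp only [etaT, hφ.dx_dt]
  refine (congrArg (fun z => z + _ + _) h).trans ?_
  simp only [tauOn, xiOn]
  ring

theorem etaX_eq (hI : IsOpen I) (hv : ContDiffOn ℝ ∞ v (dom I)) (hφ : Smooth₂ φ) {t : ℝ}
    (ht : t ∈ I) (x : ℝ) : etaX v φ t x = totX v.eta φ t x - totX v.tau φ t x * dt φ t x
      - totX v.xi φ t x * dx φ t x := by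
  have h1 := hasDx_comp hI hv.fst hφ
  have h2 := hasDx_comp hI hv.snd.fst hφ
  have h3 := hasDx_comp hI hv.snd.snd hφ
  have h := ((h3.sub (h1.mul (hφ.dt.hasDx I))).sub (h2.mul (hφ.dx.hasDx I))).dx_eq ht x
  simp only [etaX]
  refine (congrArg (fun z => z + _ + _) h).trans ?_
  simp only [tauOn, xiOn, hφ.dx_dt]
  ring

/-- The Leibniz expansion of `D_t D_x D_x Q`, in three steps `q1`, `q2`, `q3`. The derivatives of
order four cancel, and what remains displays the coefficients `-2 D_x τ` of `u_ttx` and `-D_t ξ` of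
`u_xxx`, from which the elimination starts. -/
theorem etaXXT_eq (hI : IsOpen I) (hv : ContDiffOn ℝ ∞ v (dom I)) (hφ : Smooth₂ φ) {t : ℝ}
    (ht : t ∈ I) (x : ℝ) : etaXXT v φ t x = totXXT v.eta φ t x
      - (totXXT v.tau φ t x * dt φ t x + totXX v.tau φ t x * dt (dt φ) t x
        + 2 * totXT v.tau φ t x * dt (dx φ) t x + 2 * totX v.tau φ t x * dt (dt (dx φ)) t x
        + totT v.tau φ t x * dt (dx (dx φ)) t x)
      - (totXXT v.xi φ t x * dx φ t x + totXX v.xi φ t x * dt (dx φ) t x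
        + 2 * totXT v.xi φ t x * dx (dx φ) t x + 2 * totX v.xi φ t x * dt (dx (dx φ)) t x
        + totT v.xi φ t x * dx (dx (dx φ)) t x) := by
  have q1 := ((hasDx_comp hI hv.snd.snd hφ).sub
    ((hasDx_comp hI hv.fst hφ).mul (hφ.dt.hasDx I))).sub
    ((hasDx_comp hI hv.snd.fst hφ).mul (hφ.dx.hasDx I))
  have q2 := ((hasDx_totX hI hv.snd.snd hφ).sub
    (((hasDx_totX hI hv.fst hφ).mul (hφ.dt.hasDx I)).add
      ((hasDx_comp hI hv.fst hφ).mul (hφ.dt.dx.hasDx I)))).sub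
    (((hasDx_totX hI hv.snd.fst hφ).mul (hφ.dx.hasDx I)).add
      ((hasDx_comp hI hv.snd.fst hφ).mul (hφ.dx.dx.hasDx I)))
  have q3 := ((hasDt_totXX hI hv.snd.snd hφ).sub
    ((((hasDt_totXX hI hv.fst hφ).mul (hφ.dt.hasDt I)).add
        ((hasDt_totX hI hv.fst hφ).mul (hφ.dt.dx.hasDt I))).add
      (((hasDt_totX hI hv.fst hφ).mul (hφ.dt.dx.hasDt I)).add
        ((hasDt_comp hI hv.fst hφ).mul (hφ.dt.dx.dx.hasDt I))))).sub
    ((((hasDt_totXX hI hv.snd.fst hφ).mul (hφ.dx.hasDt I)).add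
        ((hasDt_totX hI hv.snd.fst hφ).mul (hφ.dx.dx.hasDt I))).add
      (((hasDt_totX hI hv.snd.fst hφ).mul (hφ.dx.dx.hasDt I)).add
        ((hasDt_comp hI hv.snd.fst hφ).mul (hφ.dx.dx.dx.hasDt I))))
  have h := dt_dx_dx_eq hI q1 q2 q3 ht x
  simp only [etaXXT]
  refine (congrArg (fun z => z + _ + _) h).trans ?_
  simp only [tauOn, xiOn, hφ.dx_dt, hφ.dx.dx_dt, hφ.dx.dx.dx_dt]
  ring

end Prolongation

/-! ### The invariance criterion -/

/-- The third prolongation of `v` applied to the left-hand side, evaluated on `u = φ(t,x)`. -/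
noncomputable def prolongedLhs (E : Equation) (v : VectorField) (φ : ℝ → ℝ → ℝ) (t x : ℝ) : ℝ :=
  tauOn v φ t x * ((deriv E.f t + deriv E.g t * φ t x) * dx φ t x
    + deriv E.h t * dt (dx (dx φ)) t x)
  + etaT v φ t x + (E.f t + E.g t * φ t x) * etaX v φ t x + E.g t * etaOn v φ t x * dx φ t x
  + E.h t * etaXXT v φ t x

theorem Equation.hasDerivAt_f (E : Equation) {t : ℝ} (ht : t ∈ E.I) :
    HasDerivAt E.f (deriv E.f t) t :=
  (differentiableAt_of_contDiffOn E.isOpen_I E.smooth_f ht).hasDerivAt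

theorem Equation.hasDerivAt_g (E : Equation) {t : ℝ} (ht : t ∈ E.I) :
    HasDerivAt E.g (deriv E.g t) t :=
  (differentiableAt_of_contDiffOn E.isOpen_I E.smooth_g ht).hasDerivAt

theorem Equation.hasDerivAt_h (E : Equation) {t : ℝ} (ht : t ∈ E.I) :
    HasDerivAt E.h (deriv E.h t) t :=
  (differentiableAt_of_contDiffOn E.isOpen_I E.smooth_h ht).hasDerivAt

theorem deriv_lhs_line (E : Equation) {t : ℝ} (ht : t ∈ E.I) (u p q r t' u' p' q' r' : ℝ) :
    deriv (fun s : ℝ => E.lhs (t + s * t') (u + s * u') (p + s * p') (q + s * q') (r + s * r')) 0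
      = t' * ((deriv E.f t + deriv E.g t * u) * q + deriv E.h t * r)
        + p' + (E.f t + E.g t * u) * q' + E.g t * u' * q + E.h t * r' := by
  have line : ∀ a b : ℝ, HasDerivAt (fun s : ℝ => a + s * b) b 0 := fun a b => by
    simpa using ((hasDerivAt_id (0 : ℝ)).mul_const b).const_add a
  have ht' : t + 0 * t' ∈ E.I := by simpa using ht
  have hf := (E.hasDerivAt_f ht').comp (0 : ℝ) (line t t')
  have hg := (E.hasDerivAt_g ht').comp (0 : ℝ) (line t t')
  have hh := (E.hasDerivAt_h ht').comp (0 : ℝ) (line t t')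
  have h := (((line p p').add (hf.mul (line q q'))).add
    ((hg.mul (line u u')).mul (line q q'))).add (hh.mul (line r r'))
  refine (HasDerivAt.deriv (f := fun s : ℝ => E.lhs (t + s * t') (u + s * u') (p + s * p')
    (q + s * q') (r + s * r')) h).trans ?_
  simp only [Pi.mul_apply, Function.comp_apply, zero_mul, add_zero]
  ring

theorem isLieSymmetry_iff (E : Equation) (v : VectorField) : IsLieSymmetry E v ↔
    ContDiffOn ℝ ∞ v (dom E.I) ∧ ∀ φ, Smooth₂ φ → ∀ t ∈ E.I, ∀ x,
      E.lhs t (φ t x) (dt φ t x) (dx φ t x) (dt (dx (dx φ)) t x) = 0 →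
        prolongedLhs E v φ t x = 0 := by
  refine and_congr_right fun _ => forall₂_congr fun φ _ => forall₂_congr fun t ht =>
    forall_congr' fun x => ?_
  rw [deriv_lhs_line E ht]
  rfl

/-! ### Functions with a prescribed jet -/

/-- Along each coordinate line the polynomial of `exists_jet` and its derivatives have this shape,
so one formula covers all partial derivatives. -/
theorem deriv_of_eq_cubic {F : ℝ → ℝ} (a b c d s₀ : ℝ)
    (h : ∀ s, F s = a + b * (s - s₀) + c * (s - s₀) ^ 2 + d * (s - s₀) ^ 3) (s : ℝ) :
    deriv F s = b + 2 * c * (s - s₀) + 3 * d * (s - s₀) ^ 2 := by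
  rw [funext h]
  have h0 : HasDerivAt (fun s : ℝ => s - s₀) 1 s := (hasDerivAt_id s).sub_const s₀
  have := (((h0.const_mul b).const_add a).add ((h0.pow 2).const_mul c)).add
    ((h0.pow 3).const_mul d)
  refine (HasDerivAt.deriv this).trans ?_
  push_cast
  ring

/-- The Taylor polynomial with these coefficients. The derivative `u_tt` is fixed at zero, since its
freedom is not needed for the elimination. -/
theorem exists_jet (t₀ x₀ u ut ux utx uxx uttx uxxt uxxx : ℝ) : ∃ φ, Smooth₂ φ ∧
    φ t₀ x₀ = u ∧ dt φ t₀ x₀ = ut ∧ dx φ t₀ x₀ = ux ∧ dt (dt φ) t₀ x₀ = 0 ∧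
    dt (dx φ) t₀ x₀ = utx ∧ dx (dx φ) t₀ x₀ = uxx ∧ dt (dt (dx φ)) t₀ x₀ = uttx ∧
    dt (dx (dx φ)) t₀ x₀ = uxxt ∧ dx (dx (dx φ)) t₀ x₀ = uxxx := by
  set φ : ℝ → ℝ → ℝ := fun t x => u + ut * (t - t₀) + ux * (x - x₀) + utx * (t - t₀) * (x - x₀)
    + uxx / 2 * (x - x₀) ^ 2 + uttx / 2 * (t - t₀) ^ 2 * (x - x₀)
    + uxxt / 2 * (t - t₀) * (x - x₀) ^ 2 + uxxx / 6 * (x - x₀) ^ 3 with hφ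
  have ht : dt φ = fun t x => ut + utx * (x - x₀) + uttx * (t - t₀) * (x - x₀)
      + uxxt / 2 * (x - x₀) ^ 2 := by
    funext t x
    exact (deriv_of_eq_cubic (u + ux * (x - x₀) + uxx / 2 * (x - x₀) ^ 2 + uxxx / 6 * (x - x₀) ^ 3)
      (ut + utx * (x - x₀) + uxxt / 2 * (x - x₀) ^ 2) (uttx / 2 * (x - x₀)) 0 t₀
      (fun s => by simp only [hφ]; ring) t).trans (by ring)
  have hx : dx φ = fun t x => ux + utx * (t - t₀) + uxx * (x - x₀) + uttx / 2 * (t - t₀) ^ 2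
      + uxxt * (t - t₀) * (x - x₀) + uxxx / 2 * (x - x₀) ^ 2 := by
    funext t x
    exact (deriv_of_eq_cubic (u + ut * (t - t₀)) (ux + utx * (t - t₀) + uttx / 2 * (t - t₀) ^ 2)
      (uxx / 2 + uxxt / 2 * (t - t₀)) (uxxx / 6) x₀
      (fun s => by simp only [hφ]; ring) x).trans (by ring)
  have htt : dt (dt φ) = fun _ x => uttx * (x - x₀) := by
    funext t x
    rw [ht]
    exact (deriv_of_eq_cubic (ut + utx * (x - x₀) + uxxt / 2 * (x - x₀) ^ 2)
      (uttx * (x - x₀)) 0 0 t₀ (fun s => by ring) t).trans (by ring)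
  have htx : dt (dx φ) = fun t x => utx + uttx * (t - t₀) + uxxt * (x - x₀) := by
    funext t x
    rw [hx]
    exact (deriv_of_eq_cubic (ux + uxx * (x - x₀) + uxxx / 2 * (x - x₀) ^ 2)
      (utx + uxxt * (x - x₀)) (uttx / 2) 0 t₀ (fun s => by ring) t).trans (by ring)
  have hxx : dx (dx φ) = fun t x => uxx + uxxt * (t - t₀) + uxxx * (x - x₀) := by
    funext t x
    rw [hx]
    exact (deriv_of_eq_cubic (ux + utx * (t - t₀) + uttx / 2 * (t - t₀) ^ 2)
      (uxx + uxxt * (t - t₀)) (uxxx / 2) 0 x₀ (fun s => by ring) x).trans (by ring)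
  have httx : dt (dt (dx φ)) = fun _ _ => uttx := by
    funext t x
    rw [htx]
    exact (deriv_of_eq_cubic (utx + uxxt * (x - x₀)) uttx 0 0 t₀ (fun s => by ring) t).trans
      (by ring)
  have hxxt : dt (dx (dx φ)) = fun _ _ => uxxt := by
    funext t x
    rw [hxx]
    exact (deriv_of_eq_cubic (uxx + uxxx * (x - x₀)) uxxt 0 0 t₀ (fun s => by ring) t).trans
      (by ring)
  have hxxx : dx (dx (dx φ)) = fun _ _ => uxxx := by
    funext t x
    rw [hxx]
    exact (deriv_of_eq_cubic (uxx + uxxt * (t - t₀)) uxxx 0 0 x₀ (fun s => by ring) x).trans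
      (by ring)
  have hs : Smooth₂ φ := by
    simp only [Smooth₂, hφ]
    fun_prop
  refine ⟨φ, hs, ?_⟩
  rw [htt, httx, hxxt, hxxx, htx, hxx, ht, hx]
  simp [hφ]

/-! ### The determining equations -/

section Determining

variable {I : Set ℝ} {W : ℝ × ℝ × ℝ → ℝ} {φ : ℝ → ℝ → ℝ}

theorem tot_of_pX_pU_zero (hI : IsOpen I) (hX : ∀ p ∈ dom I, pX W p = 0)
    (hU : ∀ p ∈ dom I, pU W p = 0) {t : ℝ} (ht : t ∈ I) (x : ℝ) :
    totT W φ t x = pT W (t, x, φ t x) ∧ totX W φ t x = 0 ∧ totXX W φ t x = 0 ∧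
      totXT W φ t x = 0 ∧ totXXT W φ t x = 0 := by
  have hp : (t, x, φ t x) ∈ dom I := ht
  have z {W' : ℝ × ℝ × ℝ → ℝ} (h : ∀ p ∈ dom I, W' p = 0) (e) := pd_eq_zero (isOpen_dom hI) h e
  refine ⟨?_, ?_, ?_, ?_, ?_⟩ <;>
  simp [totT, totX, totXX, totXT, totXXT, hU _ hp, hX _ hp, z hX _ _ hp, z hU _ _ hp,
    z (z hX _) _ _ hp, z (z hU _) _ _ hp]

theorem tot_of_pT_pU_zero (hI : IsOpen I) (hW : ContDiffOn ℝ ∞ W (dom I))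
    (hT : ∀ p ∈ dom I, pT W p = 0) (hU : ∀ p ∈ dom I, pU W p = 0) {t : ℝ} (ht : t ∈ I) (x : ℝ) :
    totT W φ t x = 0 ∧ totX W φ t x = pX W (t, x, φ t x) ∧
      totXX W φ t x = pX (pX W) (t, x, φ t x) ∧
      totXT W φ t x = 0 ∧ totXXT W φ t x = 0 := by
  have ho := isOpen_dom hI
  have hp : (t, x, φ t x) ∈ dom I := ht
  have z {W' : ℝ × ℝ × ℝ → ℝ} (h : ∀ p ∈ dom I, W' p = 0) (e) := pd_eq_zero ho h e
  have hWX := contDiffOn_pd ho hW (0, 1, 0)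
  have hTX : ∀ p ∈ dom I, pT (pX W) p = 0 := fun p hp => 
    (pd_comm ho hW _ _ hp).trans (z hT _ p hp)
  have hUX : ∀ p ∈ dom I, pU (pX W) p = 0 := fun p hp => 
    (pd_comm ho hW _ _ hp).trans (z hU _ p hp)
  have hTXX : ∀ p ∈ dom I, pT (pX (pX W)) p = 0 := fun p hp => 
    (pd_comm ho hWX _ _ hp).trans (z hTX _ p hp)
  have hUXX : ∀ p ∈ dom I, pU (pX (pX W)) p = 0 := fun p hp => 
    (pd_comm ho hWX _ _ hp).trans (z hUX _ p hp)
  refine ⟨?_, ?_, ?_, ?_, ?_⟩ <;>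
  simp [totT, totX, totXX, totXT, totXXT, hU _ hp, hT _ hp, z hU _ _ hp, hTX _ hp, hUX _ hp,
    hTXX _ hp, hUXX _ hp, z hUX _ _ hp, z (z hU _) _ _ hp]

theorem prolongedLhs_reduced (E : Equation) {v : VectorField} (hv : ContDiffOn ℝ ∞ v (dom E.I))
    (hτX : ∀ p ∈ dom E.I, pX v.tau p = 0) (hτU : ∀ p ∈ dom E.I, pU v.tau p = 0)
    (hξT : ∀ p ∈ dom E.I, pT v.xi p = 0) (hξU : ∀ p ∈ dom E.I, pU v.xi p = 0)
    (hφ : Smooth₂ φ) {t : ℝ} (ht : t ∈ E.I) (x : ℝ) :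
    prolongedLhs E v φ t x = v.tau (t, x, φ t x) *
        ((deriv E.f t + deriv E.g t * φ t x) * dx φ t x + deriv E.h t * dt (dx (dx φ)) t x)
      + (totT v.eta φ t x - pT v.tau (t, x, φ t x) * dt φ t x)
      + (E.f t + E.g t * φ t x) * (totX v.eta φ t x - pX v.xi (t, x, φ t x) * dx φ t x)
      + E.g t * v.eta (t, x, φ t x) * dx φ t x
      + E.h t * (totXXT v.eta φ t x - pT v.tau (t, x, φ t x) * dt (dx (dx φ)) t x
        - pX (pX v.xi) (t, x, φ t x) * dt (dx φ) t x
        - 2 * pX v.xi (t, x, φ t x) * dt (dx (dx φ)) t x) := by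
  obtain ⟨a1, a2, a3, a4, a5⟩ := tot_of_pX_pU_zero (φ := φ) E.isOpen_I hτX hτU ht x
  obtain ⟨b1, b2, b3, b4, b5⟩ := tot_of_pT_pU_zero (φ := φ) E.isOpen_I hv.snd.fst hξT hξU ht x
  rw [prolongedLhs, etaT_eq E.isOpen_I hv hφ ht, etaX_eq E.isOpen_I hv hφ ht,
    etaXXT_eq E.isOpen_I hv hφ ht]
  simp only [a1, a2, a3, a4, a5, b1, b2, b3, b4, b5, tauOn, etaOn]
  ring

/-- The derivatives `u_ttx` and `u_xxx` do not enter the equation, so their coefficients `-2 h D_x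
τ` and `-h D_t ξ` vanish. As `u_x` and `u_t` are free too, both parts of each total derivative
vanish. -/
theorem IsLieSymmetry.tau_xi_partials {E : Equation} {v : VectorField} (h : IsLieSymmetry E v) :
    (∀ p ∈ dom E.I, pX v.tau p = 0) ∧ (∀ p ∈ dom E.I, pU v.tau p = 0) ∧
      (∀ p ∈ dom E.I, pT v.xi p = 0) ∧ ∀ p ∈ dom E.I, pU v.xi p = 0 := by
  obtain ⟨hv, hs⟩ := (isLieSymmetry_iff E v).1 h
  have key : ∀ t ∈ E.I, ∀ x u ut ux uxxt : ℝ, ut + E.f t * ux + E.g t * u * ux + E.h t * uxxt = 0 →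
      pX v.tau (t, x, u) + pU v.tau (t, x, u) * ux = 0 ∧
      pT v.xi (t, x, u) + pU v.xi (t, x, u) * ut = 0 := by
    intro t ht x u ut ux uxxt hl
    have ev : ∀ uttx uxxx : ℝ, ∃ φ, prolongedLhs E v φ t x = 0 ∧ Smooth₂ φ ∧
        φ t x = u ∧ dt φ t x = ut ∧ dx φ t x = ux ∧ dt (dt φ) t x = 0 ∧
        dt (dx φ) t x = 0 ∧ dx (dx φ) t x = 0 ∧ dt (dt (dx φ)) t x = uttx ∧
        dt (dx (dx φ)) t x = uxxt ∧ dx (dx (dx φ)) t x = uxxx := by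
      intro uttx uxxx
      obtain ⟨φ, hφ, j⟩ := exists_jet t x u ut ux 0 0 uttx uxxt uxxx
      exact ⟨φ, hs φ hφ t ht x (by simp only [Equation.lhs, j, hl]), hφ, j⟩
    -- Three jets that differ only in `u_ttx` or `u_xxx`; differences of the criterion isolate one
    -- coefficient each.
    obtain ⟨φ, e0, hφ, j0, j1, j2, j3, j4, j5, j6, j7, j8⟩ := ev 0 0
    obtain ⟨ψ, e1, hψ, k0, k1, k2, k3, k4, k5, k6, k7, k8⟩ := ev 1 0
    obtain ⟨χ, e2, hχ, l0, l1, l2, l3, l4, l5, l6, l7, l8⟩ := ev 0 1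
    rw [prolongedLhs, etaT_eq E.isOpen_I hv hφ ht, etaX_eq E.isOpen_I hv hφ ht,
      etaXXT_eq E.isOpen_I hv hφ ht] at e0
    rw [prolongedLhs, etaT_eq E.isOpen_I hv hψ ht, etaX_eq E.isOpen_I hv hψ ht,
      etaXXT_eq E.isOpen_I hv hψ ht] at e1
    rw [prolongedLhs, etaT_eq E.isOpen_I hv hχ ht, etaX_eq E.isOpen_I hv hχ ht,
      etaXXT_eq E.isOpen_I hv hχ ht] at e2
    simp only [totXXT, totXX, totXT, totX, totT, tauOn, etaOn, j0, j1, j2, j3, j4, j5, j6, j7,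
      j8] at e0
    simp only [totXXT, totXX, totXT, totX, totT, tauOn, etaOn, k0, k1, k2, k3, k4, k5, k6, k7,
      k8] at e1
    simp only [totXXT, totXX, totXT, totX, totT, tauOn, etaOn, l0, l1, l2, l3, l4, l5, l6, l7,
      l8] at e2
    constructor <;> refine mul_left_cancel₀ (E.h_ne_zero t ht) ?_
    · linear_combination (e0 - e1) / 2
    · linear_combination e0 - e2
  have hh : ∀ t ∈ E.I, E.h t ≠ 0 := E.h_ne_zero
  -- Solving the equation for `u_xxt` leaves `u`, `u_t`, `u_x` arbitrary.
  have sol : ∀ t ∈ E.I, ∀ u ut ux : ℝ,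
      ut + E.f t * ux + E.g t * u * ux + E.h t * (-(ut + E.f t * ux + E.g t * u * ux) / E.h t) = 0 := by
    intro t ht u ut ux
    have := hh t ht
    field_simp
    ring
  have k0 := fun t ht x u => key t ht x u 0 0 _ (sol t ht u 0 0)
  have k1 := fun t ht x u => key t ht x u 1 1 _ (sol t ht u 1 1)
  refine ⟨fun ⟨t, x, u⟩ ht => ?_, fun ⟨t, x, u⟩ ht => ?_, fun ⟨t, x, u⟩ ht => ?_,
    fun ⟨t, x, u⟩ ht => ?_⟩
  · linear_combination (k0 t ht x u).1
  · linear_combination (k1 t ht x u).1 - (k0 t ht x u).1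
  · linear_combination (k0 t ht x u).2
  · linear_combination (k1 t ht x u).2 - (k0 t ht x u).2

theorem hasDerivAt_line (hI : IsOpen I) (hW : ContDiffOn ℝ ∞ W (dom I)) {p : ℝ × ℝ × ℝ}
    (hp : p ∈ dom I) (e : ℝ × ℝ) (s : ℝ) :
    HasDerivAt (fun r : ℝ => W (p.1, p.2 + r • e)) (pd (0, e) W (p.1, p.2 + s • e)) s := by
  have h1 := (differentiableAt_of_contDiffOn (isOpen_dom hI) hW
    (p := (p.1, p.2 + s • e)) hp).hasFDerivAt
  refine h1.comp_hasDerivAt s ((hasDerivAt_const s p.1).prodMk ?_)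
  simpa using ((hasDerivAt_id s).smul_const e).const_add p.2

theorem eq_of_pU_zero (hI : IsOpen I) (hW : ContDiffOn ℝ ∞ W (dom I))
    (hU : ∀ p ∈ dom I, pU W p = 0) {t : ℝ} (ht : t ∈ I) (x u : ℝ) :
    W (t, x, u) = W (t, x, 0) := by
  have h := hasDerivAt_line hI hW (p := (t, x, 0)) ht (0, 1)
  have := is_const_of_deriv_eq_zero (fun s => (h s).differentiableAt)
    (fun s => (h s).deriv.trans (hU _ ht)) u 0
  simpa using this

theorem eq_of_pX_zero (hI : IsOpen I) (hW : ContDiffOn ℝ ∞ W (dom I))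
    (hX : ∀ p ∈ dom I, pX W p = 0) {t : ℝ} (ht : t ∈ I) (x u : ℝ) :
    W (t, x, u) = W (t, 0, u) := by
  have h := hasDerivAt_line hI hW (p := (t, 0, u)) ht (1, 0)
  have := is_const_of_deriv_eq_zero (fun s => (h s).differentiableAt)
    (fun s => (h s).deriv.trans (hX _ ht)) x 0
  simpa using this

theorem eq_affine_of_pU_pU_zero (hI : IsOpen I) (hW : ContDiffOn ℝ ∞ W (dom I))
    (hU : ∀ p ∈ dom I, pU (pU W) p = 0) {t : ℝ} (ht : t ∈ I) (x u : ℝ) :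
    W (t, x, u) = W (t, x, 0) + pU W (t, x, 0) * u := by
  have h := fun s => (hasDerivAt_line hI hW (p := (t, x, 0)) ht (0, 1) s).sub
    ((hasDerivAt_id s).const_mul (pU W (t, x, 0)))
  have h0 := fun u => eq_of_pU_zero hI (contDiffOn_pd (isOpen_dom hI) hW _) hU ht x u
  have := is_const_of_deriv_eq_zero (fun s => (h s).differentiableAt)
    (fun s => (h s).deriv.trans (by simpa [sub_eq_zero] using h0 s)) u 0
  simp at this
  linear_combination this

/-- The determining equations that are left once `τ = τ(t)` and `ξ = ξ(x)`. -/
theorem IsLieSymmetry.determining {E : Equation} {v : VectorField} (h : IsLieSymmetry E v) :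
    (∀ p ∈ dom E.I, pT v.eta p = 0) ∧ (∀ p ∈ dom E.I, pX v.eta p = 0) ∧
      (∀ p ∈ dom E.I, pT (pU v.eta) p = 0) ∧ (∀ p ∈ dom E.I, pX (pU v.eta) p = 0) ∧
      (∀ p ∈ dom E.I, pU (pU v.eta) p = 0) ∧ (∀ p ∈ dom E.I, pX (pX v.xi) p = 0) ∧
      (∀ p ∈ dom E.I, v.tau p * deriv E.h p.1 = 2 * pX v.xi p * E.h p.1) ∧
      ∀ p ∈ dom E.I, v.tau p * (deriv E.f p.1 + deriv E.g p.1 * p.2.2)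
        + (E.f p.1 + E.g p.1 * p.2.2) * (pT v.tau p - pX v.xi p) + E.g p.1 * v.eta p = 0 := by
  obtain ⟨hv, hs⟩ := (isLieSymmetry_iff E v).1 h
  obtain ⟨hτX, hτU, hξT, hξU⟩ := h.tau_xi_partials
  have ho := isOpen_dom E.isOpen_I
  have hη : ContDiffOn ℝ ∞ v.eta (dom E.I) := hv.snd.snd
  have z {W' : ℝ × ℝ × ℝ → ℝ} (h : ∀ p ∈ dom E.I, W' p = 0) (e) := pd_eq_zero ho h e
  have key : ∀ t ∈ E.I, ∀ x u ut ux utx uxx uxxt : ℝ,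
      ut + E.f t * ux + E.g t * u * ux + E.h t * uxxt = 0 → ∃ φ, Smooth₂ φ ∧
        φ t x = u ∧ dt φ t x = ut ∧ dx φ t x = ux ∧ dt (dx φ) t x = utx ∧ dx (dx φ) t x = uxx ∧
        dt (dx (dx φ)) t x = uxxt ∧
        v.tau (t, x, u) * ((deriv E.f t + deriv E.g t * u) * ux + deriv E.h t * uxxt)
      + (totT v.eta φ t x - pT v.tau (t, x, u) * ut)
      + (E.f t + E.g t * u) * (totX v.eta φ t x - pX v.xi (t, x, u) * ux)
      + E.g t * v.eta (t, x, u) * ux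
      + E.h t * (totXXT v.eta φ t x - pT v.tau (t, x, u) * uxxt
        - pX (pX v.xi) (t, x, u) * utx - 2 * pX v.xi (t, x, u) * uxxt) = 0 := by
    intro t ht x u ut ux utx uxx uxxt hl
    obtain ⟨φ, hφ, j0, j1, j2, j3, j4, j5, j6, j7, j8⟩ := exists_jet t x u ut ux utx uxx 0 uxxt 0
    have e := hs φ hφ t ht x (by simp only [Equation.lhs, j0, j1, j2, j7, hl])
    rw [prolongedLhs_reduced E hv hτX hτU hξT hξU hφ ht, j0, j1, j2, j4, j7] at e
    exact ⟨φ, hφ, j0, j1, j2, j4, j5, j7, e⟩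
  have sol : ∀ t ∈ E.I, ∀ u ut ux : ℝ,
      ut + E.f t * ux + E.g t * u * ux + E.h t * (-(ut + E.f t * ux + E.g t * u * ux) / E.h t) = 0 := by
    intro t ht u ut ux
    have := E.h_ne_zero t ht
    field_simp
    ring
  -- The coefficients of `u_xx` and `u_tx`, which do not enter the equation either.
  have hxx : ∀ t ∈ E.I, ∀ x u ut ux : ℝ,
      pT (pU v.eta) (t, x, u) + pU (pU v.eta) (t, x, u) * ut = 0 ∧
      pU (pX v.eta) (t, x, u) + pX (pU v.eta) (t, x, u) + 2 * pU (pU v.eta) (t, x, u) * ux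
        = pX (pX v.xi) (t, x, u) := by
    intro t ht x u ut ux
    have hl := sol t ht u ut ux
    obtain ⟨φ, hφ, j0, j1, j2, j3, j4, j5, e0⟩ := key t ht x u ut ux 0 0 _ hl
    obtain ⟨ψ, hψ, k0, k1, k2, k3, k4, k5, e1⟩ := key t ht x u ut ux 0 1 _ hl
    obtain ⟨χ, hχ, l0, l1, l2, l3, l4, l5, e2⟩ := key t ht x u ut ux 1 0 _ hl
    simp only [totXXT, totXT, totX, totT, j0, j1, j2, j3, j4, j5] at e0
    simp only [totXXT, totXT, totX, totT, k0, k1, k2, k3, k4, k5] at e1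
    simp only [totXXT, totXT, totX, totT, l0, l1, l2, l3, l4, l5] at e2
    constructor <;> refine mul_left_cancel₀ (E.h_ne_zero t ht) ?_
    · linear_combination e1 - e0
    · linear_combination e2 - e0
  have hTU : ∀ p ∈ dom E.I, pT (pU v.eta) p = 0 := fun ⟨t, x, u⟩ ht => by
    linear_combination (hxx t ht x u 0 0).1
  have hUU : ∀ p ∈ dom E.I, pU (pU v.eta) p = 0 := fun ⟨t, x, u⟩ ht => by
    linear_combination (hxx t ht x u 1 0).1 - (hxx t ht x u 0 0).1
  have comm {W : ℝ × ℝ × ℝ → ℝ} (hW : ContDiffOn ℝ ∞ W (dom E.I)) (a b : ℝ × ℝ × ℝ) :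
      Set.EqOn (pd a (pd b W)) (pd b (pd a W)) (dom E.I) := fun p hp => pd_comm ho hW a b hp
  have hηd e := contDiffOn_pd ho hη e
  have hηX := hηd (0, 1, 0)
  have hUX : ∀ p ∈ dom E.I, pU (pX v.eta) p = pX (pU v.eta) p := comm hη _ _
  have hξXX : ∀ p ∈ dom E.I, pX (pX v.xi) p = 2 * pX (pU v.eta) p := fun ⟨t, x, u⟩ ht => by
    have := (hxx t ht x u 0 0).2
    rw [hUX _ ht] at this
    linear_combination -this
  have hTUX : ∀ p ∈ dom E.I, pT (pU (pX v.eta)) p = 0 := fun p hp =>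
    ((pd_congr ho hUX _ hp).trans (comm (hηd _) _ _ hp)).trans (z hTU _ p hp)
  have hUUX : ∀ p ∈ dom E.I, pU (pU (pX v.eta)) p = 0 := fun p hp =>
    ((pd_congr ho hUX _ hp).trans (comm (hηd _) _ _ hp)).trans (z hUU _ p hp)
  have hTXU : ∀ p ∈ dom E.I, pT (pX (pU v.eta)) p = 0 := fun p hp =>
    (comm (hηd _) _ _ hp).trans (z hTU _ p hp)
  have hUXU : ∀ p ∈ dom E.I, pU (pX (pU v.eta)) p = 0 := fun p hp =>
    (comm (hηd _) _ _ hp).trans (z hUU _ p hp)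
  -- Once the mixed derivatives of `η` found above are dropped, only `u_t`, `u_x` and `u_xxt` are
  -- left in the criterion.
  have red : ∀ t ∈ E.I, ∀ x u ut ux uxxt : ℝ,
      ut + E.f t * ux + E.g t * u * ux + E.h t * uxxt = 0 →
      v.tau (t, x, u) * ((deriv E.f t + deriv E.g t * u) * ux + deriv E.h t * uxxt)
      + (pT v.eta (t, x, u) + pU v.eta (t, x, u) * ut - pT v.tau (t, x, u) * ut)
      + (E.f t + E.g t * u) * (pX v.eta (t, x, u) + pU v.eta (t, x, u) * ux
        - pX v.xi (t, x, u) * ux)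
      + E.g t * v.eta (t, x, u) * ux
      + E.h t * (pT (pX (pX v.eta)) (t, x, u) + pU (pX (pX v.eta)) (t, x, u) * ut
        + pU v.eta (t, x, u) * uxxt - pT v.tau (t, x, u) * uxxt
        - 2 * pX v.xi (t, x, u) * uxxt) = 0 := by
    intro t ht x u ut ux uxxt hl
    obtain ⟨φ, hφ, j0, j1, j2, j3, j4, j5, e0⟩ := key t ht x u ut ux 0 0 _ hl
    have hp : (t, x, u) ∈ dom E.I := ht
    simp only [totXXT, totXT, totX, totT, j0, j1, j2, j3, j4, j5, hTU _ hp, hUU _ hp, hTUX _ hp,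
      hUUX _ hp, hTXU _ hp, hUXU _ hp, z hUU _ _ hp] at e0
    linear_combination e0
  -- The jet `u_t = -h`, `u_x = 0`, `u_xxt = 1` lies on the equation; it is compared with the zero
  -- jet.
  have hA : ∀ p ∈ dom E.I, v.tau p * deriv E.h p.1
      = E.h p.1 * (E.h p.1 * pU (pX (pX v.eta)) p + 2 * pX v.xi p) := fun ⟨t, x, u⟩ ht => by
    have h0 := E.h_ne_zero t ht
    have e0 := red t ht x u 0 0 0 (by ring)
    have e1 := red t ht x u (-E.h t) 0 1 (by ring)
    linear_combination e1 - e0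
  have hC : ∀ p ∈ dom E.I, pT v.eta p + (E.f p.1 + E.g p.1 * p.2.2) * pX v.eta p
      + E.h p.1 * pT (pX (pX v.eta)) p = 0 := fun ⟨t, x, u⟩ ht => by
    linear_combination red t ht x u 0 0 0 (by ring)
  have hTXX : ∀ p ∈ dom E.I, pU (pT (pX (pX v.eta))) p = 0 := fun p hp => by
    have e1 : Set.EqOn (pU (pX (pX v.eta))) (pX (pX (pU v.eta))) (dom E.I) := fun q hq =>
      (comm hηX _ _ hq).trans (pd_congr ho hUX _ hq)
    exact ((comm (contDiffOn_pd ho hηX _) _ _ hp).trans (pd_congr ho e1 _ hp)).trans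
      ((comm (contDiffOn_pd ho (hηd _) _) _ _ hp).trans (z hTXU _ p hp))
  -- Here `η_x` is affine in `u`, while `η_t` and `η_txx` do not depend on `u`. So `hC` is a
  -- quadratic polynomial in `u`, with leading coefficient `g η_xu` and linear coefficient `g η_x +
  -- f η_xu` at `u = 0`. Its values at `0` and `±1` isolate both.
  have hX : ∀ t ∈ E.I, ∀ x, pU (pX v.eta) (t, x, 0) = 0 ∧ pX v.eta (t, x, 0) = 0 := by
    intro t ht x
    have a1 := fun u => eq_affine_of_pU_pU_zero E.isOpen_I hηX hUUX ht x u
    have a2 := fun u => eq_of_pU_zero E.isOpen_I (hηd (1, 0, 0))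
      (fun p hp => (comm hη _ _ hp).trans (hTU p hp)) ht x u
    have a3 := fun u => eq_of_pU_zero E.isOpen_I
      (contDiffOn_pd ho (contDiffOn_pd ho hηX _) _) hTXX ht x u
    have e : ∀ u : ℝ, pT v.eta (t, x, 0) + (E.f t + E.g t * u)
        * (pX v.eta (t, x, 0) + pU (pX v.eta) (t, x, 0) * u)
        + E.h t * pT (pX (pX v.eta)) (t, x, 0) = 0 := fun u => by
      rw [← a1, ← a2 u, ← a3 u]
      exact hC (t, x, u) ht
    have h1 : E.g t * pU (pX v.eta) (t, x, 0) = 0 := by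
      linear_combination (e 1 + e (-1) - 2 * e 0) / 2
    have h2 := (mul_eq_zero.1 h1).resolve_left (E.g_ne_zero t ht)
    refine ⟨h2, mul_left_cancel₀ (E.g_ne_zero t ht) ?_⟩
    linear_combination (e 1 - e (-1)) / 2 - E.f t * h2
  have hX0 : ∀ p ∈ dom E.I, pX v.eta p = 0 := fun ⟨t, x, u⟩ ht => by
    have := eq_affine_of_pU_pU_zero E.isOpen_I hηX hUUX ht x u
    rw [(hX t ht x).1, (hX t ht x).2] at this
    linear_combination this
  have hXU0 : ∀ p ∈ dom E.I, pX (pU v.eta) p = 0 := fun p hp =>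
    (hUX p hp).symm.trans (z hX0 _ p hp)
  have hUXX0 : ∀ p ∈ dom E.I, pU (pX (pX v.eta)) p = 0 := z (z hX0 _) _
  have hTXX0 : ∀ p ∈ dom E.I, pT (pX (pX v.eta)) p = 0 := z (z hX0 _) _
  have hT0 : ∀ p ∈ dom E.I, pT v.eta p = 0 := fun p hp => by
    have := hC p hp
    rw [hX0 p hp, hTXX0 p hp] at this
    linear_combination this
  have hA0 : ∀ p ∈ dom E.I, v.tau p * deriv E.h p.1 = 2 * pX v.xi p * E.h p.1 := fun p hp => by
    rw [hA p hp, hUXX0 p hp]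
    ring
  refine ⟨hT0, hX0, hTU, hXU0, hUU, fun p hp => by rw [hξXX p hp, hXU0 p hp, mul_zero], hA0, ?_⟩
  rintro ⟨t, x, u⟩ ht
  -- On this jet `u_xxt = 0`, and the two terms with `η_u` cancel.
  have e := red t ht x u (-(E.f t + E.g t * u)) 1 0 (by ring)
  rw [hT0 _ ht, hX0 _ ht, hTXX0 _ ht, hUXX0 _ ht] at e
  linear_combination e

theorem eqOn_const_of_partials_zero (hI : IsOpen I) (hc : I.OrdConnected)
    (hW : ContDiffOn ℝ ∞ W (dom I)) (hT : ∀ p ∈ dom I, pT W p = 0) (hX : ∀ p ∈ dom I, pX W p = 0)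
    (hU : ∀ p ∈ dom I, pU W p = 0) : ∃ c, ∀ p ∈ dom I, W p = c := by
  have hconv : Convex ℝ (dom I) := hc.convex.linear_preimage (LinearMap.fst ℝ ℝ (ℝ × ℝ))
  refine eqOn_const_of_fderiv_zero (isOpen_dom hI) hconv.isPreconnected hW fun p hp => ?_
  refine ContinuousLinearMap.ext fun ⟨a, b, c⟩ => ?_
  have : ((a, b, c) : ℝ × ℝ × ℝ) = a • (1, 0, 0) + b • (0, 1, 0) + c • (0, 0, 1) := by
    ext <;> simp
  have e1 : fderiv ℝ W p (1, 0, 0) = 0 := hT p hp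
  have e2 : fderiv ℝ W p (0, 1, 0) = 0 := hX p hp
  have e3 : fderiv ℝ W p (0, 0, 1) = 0 := hU p hp
  rw [this, map_add, map_add, map_smul, map_smul, map_smul, e1, e2, e3]
  simp

theorem pd_sub_linear (hI : IsOpen I) (hW : ContDiffOn ℝ ∞ W (dom I)) (e : ℝ × ℝ × ℝ)
    (L : ℝ × ℝ × ℝ →L[ℝ] ℝ) {p : ℝ × ℝ × ℝ} (hp : p ∈ dom I) :
    pd e (fun q => W q - L q) p = pd e W p - L e := by
  have h := (differentiableAt_of_contDiffOn (isOpen_dom hI) hW hp).hasFDerivAt.sub L.hasFDerivAt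
  exact congrArg (fun A => A e) h.fderiv

theorem pT_eq_deriv {F : ℝ → ℝ} (hI : IsOpen I) (hWF : ∀ p ∈ dom I, W p = F p.1)
    (hW : ContDiffOn ℝ ∞ W (dom I)) {p : ℝ × ℝ × ℝ} (hp : p ∈ dom I) :
    HasDerivAt F (pT W p) p.1 := by
  have h1 := (differentiableAt_of_contDiffOn (isOpen_dom hI) hW hp).hasFDerivAt
  have h2 := HasFDerivAt.comp_hasDerivAt (f := fun s : ℝ => ((s, p.2) : ℝ × ℝ × ℝ)) p.1 h1
    ((hasDerivAt_id p.1).prodMk (hasDerivAt_const p.1 p.2))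
  refine h2.congr_of_eventuallyEq ?_
  filter_upwards [hI.mem_nhds hp] with s hs using (hWF (s, p.2) hs).symm

/-- The structure of a Lie symmetry, with the classifying conditions. -/
theorem IsLieSymmetry.exists_form {E : Equation} {v : VectorField} (h : IsLieSymmetry E v) :
    ∃ (c a α b : ℝ) (τ τ' : ℝ → ℝ),
      (∀ p ∈ dom E.I, v p = (τ p.1, a * p.2.1 + c, α * p.2.2 + b)) ∧
      ∀ t ∈ E.I, HasDerivAt τ (τ' t) t ∧ τ t * deriv E.h t = 2 * a * E.h t ∧
        τ t * deriv E.g t + τ' t * E.g t = (a - α) * E.g t ∧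
        τ t * deriv E.f t + τ' t * E.f t = a * E.f t - b * E.g t := by
  obtain ⟨hv, -⟩ := (isLieSymmetry_iff E v).1 h
  obtain ⟨hτX, hτU, hξT, hξU⟩ := h.tau_xi_partials
  obtain ⟨hT, hX, hTU, hXU, hUU, hXX, hh, hfg⟩ := h.determining
  have ho := isOpen_dom E.isOpen_I
  have hη : ContDiffOn ℝ ∞ v.eta (dom E.I) := hv.snd.snd
  have hξ : ContDiffOn ℝ ∞ v.xi (dom E.I) := hv.snd.fst
  have hτ : ContDiffOn ℝ ∞ v.tau (dom E.I) := hv.fst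
  -- All partial derivatives of `η_u` and `ξ_x` vanish, so these are constants `α` and `a`; below,
  -- the same argument applies to `ξ - a x` and `η - α u`.
  obtain ⟨α, hα⟩ := eqOn_const_of_partials_zero E.isOpen_I E.ordConnected_I
    (contDiffOn_pd ho hη (0, 0, 1)) hTU hXU hUU
  obtain ⟨a, ha⟩ := eqOn_const_of_partials_zero E.isOpen_I E.ordConnected_I
    (contDiffOn_pd ho hξ (0, 1, 0))
    (fun p hp => (pd_comm ho hξ _ _ hp).trans (pd_eq_zero ho hξT _ p hp)) hXX
    (fun p hp => (pd_comm ho hξ _ _ hp).trans (pd_eq_zero ho hξU _ p hp))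
  have smooth_sub {W : ℝ × ℝ × ℝ → ℝ} (hW : ContDiffOn ℝ ∞ W (dom E.I))
      (L : ℝ × ℝ × ℝ →L[ℝ] ℝ) : ContDiffOn ℝ ∞ (fun q => W q - L q) (dom E.I) :=
    hW.sub L.contDiff.contDiffOn
  let Lx : ℝ × ℝ × ℝ →L[ℝ] ℝ := (ContinuousLinearMap.fst ℝ ℝ ℝ).comp (.snd ℝ ℝ (ℝ × ℝ))
  let Lu : ℝ × ℝ × ℝ →L[ℝ] ℝ := (ContinuousLinearMap.snd ℝ ℝ ℝ).comp (.snd ℝ ℝ (ℝ × ℝ))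
  obtain ⟨c, hc⟩ := eqOn_const_of_partials_zero E.isOpen_I E.ordConnected_I
    (smooth_sub hξ (a • Lx))
    (fun p hp => (pd_sub_linear E.isOpen_I hξ _ _ hp).trans (by rw [hξT p hp]; simp [Lx]))
    (fun p hp => (pd_sub_linear E.isOpen_I hξ _ _ hp).trans (by rw [ha p hp]; simp [Lx]))
    (fun p hp => (pd_sub_linear E.isOpen_I hξ _ _ hp).trans (by rw [hξU p hp]; simp [Lx]))
  obtain ⟨b, hb⟩ := eqOn_const_of_partials_zero E.isOpen_I E.ordConnected_I
    (smooth_sub hη (α • Lu))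
    (fun p hp => (pd_sub_linear E.isOpen_I hη _ _ hp).trans (by rw [hT p hp]; simp [Lu]))
    (fun p hp => (pd_sub_linear E.isOpen_I hη _ _ hp).trans (by rw [hX p hp]; simp [Lu]))
    (fun p hp => (pd_sub_linear E.isOpen_I hη _ _ hp).trans (by rw [hα p hp]; simp [Lu]))
  have hτ0 : ∀ p ∈ dom E.I, v.tau p = v.tau (p.1, 0, 0) := fun ⟨t, x, u⟩ ht => by
    exact (eq_of_pU_zero E.isOpen_I hτ hτU ht x u).trans (eq_of_pX_zero E.isOpen_I hτ hτX ht x 0)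
  refine ⟨c, a, α, b, fun t => v.tau (t, 0, 0), fun t => pT v.tau (t, 0, 0), ?_, ?_⟩
  · intro p hp
    have e2 : v.xi p - a * p.2.1 = c := hc p hp
    have e3 : v.eta p - α * p.2.2 = b := hb p hp
    refine Prod.ext (hτ0 p hp) (Prod.ext ?_ ?_)
    · linear_combination e2
    · linear_combination e3
  · intro t ht
    have e3 : ∀ u, v.eta (t, 0, u) - α * u = b := fun u => hb (t, 0, u) ht
    have e4 := hh (t, 0, 0) ht
    -- The last determining equation is affine in `u`: its value at `u = 0` is the condition on `f`,
    -- and the difference of its values at `1` and `0` is the condition on `g`.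
    have e5 := hfg (t, 0, 0) ht
    have e6 := hfg (t, 0, 1) ht
    have d1 := hτ0 (t, 0, 1) ht
    have d2 : pT v.tau (t, 0, 1) = pT v.tau (t, 0, 0) :=
      (pT_eq_deriv (F := fun t => v.tau (t, 0, 0)) E.isOpen_I hτ0 hτ (p := (t, 0, 1)) ht).unique
        (pT_eq_deriv (F := fun t => v.tau (t, 0, 0)) E.isOpen_I hτ0 hτ (p := (t, 0, 0)) ht)
    rw [ha _ ht] at e4 e5 e6
    rw [d2] at e6
    refine ⟨pT_eq_deriv (F := fun t => v.tau (t, 0, 0)) E.isOpen_I hτ0 hτ (p := (t, 0, 0)) ht, e4, ?_, ?_⟩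
    · linear_combination e6 - e5 - E.g t * (e3 1 - e3 0)
        - (deriv E.f t + deriv E.g t) * d1
    · linear_combination e5 - E.g t * e3 0

theorem isLieSymmetry_of_form {E : Equation} {v : VectorField} {c a α b : ℝ} {τ τ' : ℝ → ℝ}
    (hτs : ContDiffOn ℝ ∞ τ E.I)
    (hvf : ∀ p ∈ dom E.I, v p = (τ p.1, a * p.2.1 + c, α * p.2.2 + b))
    (he : ∀ t ∈ E.I, HasDerivAt τ (τ' t) t ∧ τ t * deriv E.h t = 2 * a * E.h t ∧
      τ t * deriv E.g t + τ' t * E.g t = (a - α) * E.g t ∧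
      τ t * deriv E.f t + τ' t * E.f t = a * E.f t - b * E.g t) : IsLieSymmetry E v := by
  have ho := isOpen_dom E.isOpen_I
  have hv : ContDiffOn ℝ ∞ v (dom E.I) := by
    refine ContDiffOn.congr (ContDiffOn.prodMk (hτs.comp contDiffOn_fst fun p hp => hp) ?_) hvf
    fun_prop
  have hτ : Set.EqOn v.tau (fun p => τ p.1) (dom E.I) := fun p hp => by
    simp only [VectorField.tau, hvf p hp]
  have hξ : Set.EqOn v.xi (fun p => a * p.2.1 + c) (dom E.I) := fun p hp => by
    simp only [VectorField.xi, hvf p hp]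
  have hη : Set.EqOn v.eta (fun p => α * p.2.2 + b) (dom E.I) := fun p hp => by
    simp only [VectorField.eta, hvf p hp]
  have dτ : ∀ p ∈ dom E.I, ∀ e, pd e v.tau p = e.1 * τ' p.1 := by
    intro p hp e
    rw [pd_congr ho hτ e hp]
    have : HasFDerivAt (fun p : ℝ × ℝ × ℝ => τ p.1) _ p :=
      (he p.1 hp).1.comp_hasFDerivAt p (hasFDerivAt_fst (𝕜 := ℝ) (p := p))
    simp [pd, this.fderiv, mul_comm]
  have dξ : ∀ p ∈ dom E.I, ∀ e, pd e v.xi p = a * e.2.1 := by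
    intro p hp e
    rw [pd_congr ho hξ e hp]
    have : HasFDerivAt (fun p : ℝ × ℝ × ℝ => a * p.2.1 + c) _ p :=
      ((hasFDerivAt_fst.comp p (hasFDerivAt_snd (𝕜 := ℝ) (p := p))).const_mul a).add_const c
    simp [pd, this.fderiv]
  have dη : ∀ p ∈ dom E.I, ∀ e, pd e v.eta p = α * e.2.2 := by
    intro p hp e
    rw [pd_congr ho hη e hp]
    have : HasFDerivAt (fun p : ℝ × ℝ × ℝ => α * p.2.2 + b) _ p :=
      ((hasFDerivAt_snd.comp p (hasFDerivAt_snd (𝕜 := ℝ) (p := p))).const_mul α).add_const b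
    simp [pd, this.fderiv]
  refine (isLieSymmetry_iff E v).2 ⟨hv, fun φ hφ t ht x hl => ?_⟩
  rw [prolongedLhs_reduced E hv (fun p hp => by simp [dτ p hp]) (fun p hp => by simp [dτ p hp])
    (fun p hp => by simp [dξ p hp]) (fun p hp => by simp [dξ p hp]) hφ ht]
  have hp : (t, x, φ t x) ∈ dom E.I := ht
  have d0 {W : ℝ × ℝ × ℝ → ℝ} {k : ℝ} (h : ∀ p ∈ dom E.I, W p = k) :
      ∀ p ∈ dom E.I, ∀ e, pd e W p = 0 := fun p hp e => by
    rw [pd_congr (W' := fun _ => k) ho h e hp]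
    simp [pd]
  have hX : ∀ p ∈ dom E.I, pX v.eta p = 0 := fun p hp => by simp [dη p hp]
  have hU : ∀ p ∈ dom E.I, pU v.eta p = α := fun p hp => by simp [dη p hp]
  have hξX : ∀ p ∈ dom E.I, pX v.xi p = a := fun p hp => by simp [dξ p hp]
  have hT : pT v.eta (t, x, φ t x) = 0 := by simp [dη _ hp]
  have z := d0 hX
  have zU := d0 hU
  have zXX := d0 (fun p hp => z p hp (0, 1, 0))
  have zUX := d0 (fun p hp => z p hp (0, 0, 1))
  have zXU := d0 (fun p hp => zU p hp (0, 1, 0))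
  have zUU := d0 (fun p hp => zU p hp (0, 0, 1))
  obtain ⟨-, e1, e2, e3⟩ := he t ht
  simp only [totXXT, totXT, totX, totT, hX _ hp, hU _ hp, hT, z _ hp, zU _ hp, zXX _ hp, zUX _ hp,
    zXU _ hp, zUU _ hp, hξX _ hp, d0 hξX _ hp, dτ _ hp]
  rw [hτ hp, hη hp]
  rw [Equation.lhs] at hl
  simp only
  -- The prolonged field multiplies the left-hand side of the equation by `α - τ'`, so the result
  -- vanishes on solutions.
  linear_combination dt (dx (dx φ)) t x * e1 + φ t x * dx φ t x * e2 + dx φ t x * e3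
    + (α - τ' t) * hl

end Determining

/-! ### The classifying conditions -/

section Classifying

variable {E : Equation} {T : ℝ → ℝ} {a α b k : ℝ}

/-- The ratio `f / g`. -/
noncomputable def Equation.ratio (E : Equation) : ℝ → ℝ := fun t => E.f t / E.g t

theorem Equation.hasDerivAt_ratio (E : Equation) {t : ℝ} (ht : t ∈ E.I) :
    HasDerivAt E.ratio (deriv E.ratio t) t :=
  ((E.hasDerivAt_f ht).div (E.hasDerivAt_g ht) (E.g_ne_zero t ht)).differentiableAt.hasDerivAt

theorem Equation.deriv_ratio (E : Equation) {t : ℝ} (ht : t ∈ E.I) :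
    deriv E.ratio t * E.g t ^ 2 = deriv E.f t * E.g t - E.f t * deriv E.g t := by
  have h := ((E.hasDerivAt_f ht).div (E.hasDerivAt_g ht) (E.g_ne_zero t ht)).deriv
  have h' : deriv E.ratio t = _ := h
  rw [h', div_mul_cancel₀ _ (pow_ne_zero 2 (E.g_ne_zero t ht))]

theorem Equation.f_eq (E : Equation) {t : ℝ} (ht : t ∈ E.I) : E.f t = E.g t * E.ratio t := by
  rw [Equation.ratio, mul_div_cancel₀ _ (E.g_ne_zero t ht)]

/-- The vector field `((a - α) T + k) / g ∂_t + (a x + c) ∂_x + (α u + b) ∂_u`. -/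
noncomputable def affineField (E : Equation) (T : ℝ → ℝ) (c a α b k : ℝ) : VectorField := fun p =>
  (((a - α) * T p.1 + k) / E.g p.1, a * p.2.1 + c, α * p.2.2 + b)

/-- The conditions on the coefficients under which `affineField E T c a α b k` is a symmetry. -/
def Classifying (E : Equation) (T : ℝ → ℝ) (a α b k : ℝ) : Prop := ∀ t ∈ E.I,
  ((a - α) * T t + k) * deriv E.h t = 2 * a * E.g t * E.h t ∧
  ((a - α) * T t + k) * deriv E.ratio t = E.g t * (α * E.ratio t - b)

theorem is_const_on_I (E : Equation) {F : ℝ → ℝ} (hF : ∀ t ∈ E.I, HasDerivAt F 0 t) :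
    ∃ c, ∀ t ∈ E.I, F t = c :=
  E.isOpen_I.exists_is_const_of_deriv_eq_zero E.ordConnected_I.isPreconnected
    (fun t ht => (hF t ht).differentiableAt.differentiableWithinAt) fun t ht => (hF t ht).deriv

theorem contDiffOn_of_deriv_g (hT : ∀ t ∈ E.I, HasDerivAt T (E.g t) t) : ContDiffOn ℝ ∞ T E.I := by
  refine ((contDiffOn_infty_iff_deriv_of_isOpen E.isOpen_I).2 ⟨fun t ht =>
    (hT t ht).differentiableAt.differentiableWithinAt, ?_⟩)
  exact E.smooth_g.congr fun t ht => (hT t ht).deriv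

/-- The condition on `g` reads `(τ g)' = (a - α) T'`, which integrates to `τ g = (a - α) T + k`.
This eliminates `τ`, and the condition on `f` becomes one on `f / g`. -/
theorem isLieSymmetry_iff_classifying (hT : ∀ t ∈ E.I, HasDerivAt T (E.g t) t)
    (v : VectorField) : IsLieSymmetry E v ↔ ∃ c a α b k : ℝ,
      Set.EqOn v (affineField E T c a α b k) E.domain ∧ Classifying E T a α b k := by
  constructor
  · intro h
    obtain ⟨c, a, α, b, τ, τ', hv, he⟩ := h.exists_form
    obtain ⟨k, hk⟩ := is_const_on_I E (F := fun t => τ t * E.g t - (a - α) * T t) fun t ht => by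
      refine (((he t ht).1.mul (E.hasDerivAt_g ht)).sub ((hT t ht).const_mul (a - α))).congr_deriv ?_
      linear_combination (he t ht).2.2.1
    refine ⟨c, a, α, b, k, fun p hp => ?_, fun t ht => ?_⟩
    · have h0 := E.g_ne_zero p.1 hp
      have h1 : τ p.1 = ((a - α) * T p.1 + k) / E.g p.1 := by
        rw [eq_div_iff h0]
        linear_combination hk p.1 hp
      rw [hv p hp, affineField, h1]
    · obtain ⟨-, e1, e2, e3⟩ := he t ht
      have h1 : (a - α) * T t + k = τ t * E.g t := by linear_combination -hk t ht
      rw [h1]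
      refine ⟨by linear_combination E.g t * e1, mul_right_cancel₀ (E.g_ne_zero t ht) ?_⟩
      rw [E.f_eq ht] at e3
      have e4 := E.deriv_ratio ht
      rw [E.f_eq ht] at e4
      linear_combination τ t * e4 + E.g t * e3 - E.g t * E.ratio t * e2
  · rintro ⟨c, a, α, b, k, hv, he⟩
    refine isLieSymmetry_of_form (c := c) (a := a) (α := α) (b := b)
      (τ := fun t => ((a - α) * T t + k) / E.g t)
      (τ' := fun t => ((a - α) * E.g t * E.g t - ((a - α) * T t + k) * deriv E.g t) / E.g t ^ 2)
      ?_ hv ?_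
    · exact ((contDiffOn_const.mul (contDiffOn_of_deriv_g hT)).add contDiffOn_const).div
        E.smooth_g E.g_ne_zero
    · intro t ht
      have h0 := E.g_ne_zero t ht
      obtain ⟨e1, e2⟩ := he t ht
      have e4 := E.deriv_ratio ht
      rw [E.f_eq ht] at e4 ⊢
      refine ⟨(((hT t ht).const_mul (a - α)).add_const k).div (E.hasDerivAt_g ht) h0, ?_, ?_, ?_⟩
      · field_simp
        linear_combination e1
      · field_simp
        ring
      · field_simp
        refine mul_right_cancel₀ h0 ?_
        linear_combination E.g t ^ 2 * e2 - ((a - α) * T t + k) * e4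

theorem Classifying.zero : Classifying E T 0 0 0 0 := fun t _ => by simp

/-! ### The linear structure of the symmetries modulo `∂_x`. -/

theorem Classifying.linear_combination {a' α' b' k' : ℝ} (h : Classifying E T a α b k)
    (h' : Classifying E T a' α' b' k') (m n : ℝ) :
    Classifying E T (m * a + n * a') (m * α + n * α') (m * b + n * b') (m * k + n * k') := by
  intro t ht
  obtain ⟨e1, e2⟩ := h t ht
  obtain ⟨e3, e4⟩ := h' t ht
  constructor
  · linear_combination m * e1 + n * e3
  · linear_combination m * e2 + n * e4

/-- With `τ = 0` the conditions at a single `t` already give `a = 0`, hence `α = 0` and `b = 0`. By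
linearity, the tuple is determined by `(a - α, k)`. -/
theorem Classifying.eq_zero (h : Classifying E T a α b k) (hp : a - α = 0) (hk : k = 0) :
    a = 0 ∧ α = 0 ∧ b = 0 ∧ k = 0 := by
  obtain ⟨t, ht⟩ := E.nonempty_I
  obtain ⟨e1, e2⟩ := h t ht
  have h0 := E.g_ne_zero t ht
  rw [hp, hk] at e1 e2
  have ha : a = 0 := by
    have : (2 * E.g t * E.h t) * a = 0 := by linear_combination -e1
    simpa [h0, E.h_ne_zero t ht] using this
  have hα : α = 0 := by linear_combination ha - hp
  have hb : E.g t * b = 0 := by linear_combination e2 + E.g t * E.ratio t * hα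
  exact ⟨ha, hα, (mul_eq_zero.1 hb).resolve_left h0, hk⟩

/-- The coefficients `h` and `f / g` are constant. -/
def Flat (E : Equation) : Prop := ∀ t ∈ E.I, deriv E.h t = 0 ∧ deriv E.ratio t = 0

theorem exists_antiderivative_ne (hT : ∀ t ∈ E.I, HasDerivAt T (E.g t) t) :
    ∃ t₁ ∈ E.I, ∃ t₂ ∈ E.I, T t₁ ≠ T t₂ := by
  by_contra! hc
  obtain ⟨t, ht⟩ := E.nonempty_I
  have : HasDerivAt T 0 t := (hasDerivAt_const t (T t)).congr_of_eventuallyEq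
    (Filter.eventuallyEq_of_mem (E.isOpen_I.mem_nhds ht) fun s hs => hc s hs t ht)
  exact E.g_ne_zero t ht ((hT t ht).unique this)

theorem eq_zero_of_affine (hT : ∀ t ∈ E.I, HasDerivAt T (E.g t) t) {p q : ℝ}
    (h : ∀ t ∈ E.I, p * T t + q = 0) : p = 0 ∧ q = 0 := by
  obtain ⟨t₁, h1, t₂, h2, hne⟩ := exists_antiderivative_ne hT
  have hp : p * (T t₁ - T t₂) = 0 := by linear_combination h t₁ h1 - h t₂ h2
  have hp' := (mul_eq_zero.1 hp).resolve_right (sub_ne_zero.2 hne)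
  exact ⟨hp', by linear_combination h t₁ h1 - T t₁ * hp'⟩

/-- The fields have `τ g = 1` and `τ g = T`. Their conditions on `h` give `a T = a'`, so `a = a' =
0` because `T` is not constant, and `h' = 0`. Those on `w = f / g` give `w' = -b g` and `w = b T -
b'`, so `w'` equals its own negative. -/
theorem flat_of_classifying (hT : ∀ t ∈ E.I, HasDerivAt T (E.g t) t) {a' α' b' : ℝ}
    (h : Classifying E T a α b 1) (hp : a - α = 0)
    (h' : Classifying E T a' α' b' 0) (hp' : a' - α' = 1) : Flat E := by
  have e1 : ∀ t ∈ E.I, deriv E.h t = 2 * a * E.g t * E.h t := fun t ht => by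
    linear_combination (h t ht).1 - T t * deriv E.h t * hp
  have e2 : ∀ t ∈ E.I, a * T t + -a' = 0 := fun t ht => by
    have : (2 * E.g t * E.h t) * (a * T t + -a') = 0 := by
      linear_combination (h' t ht).1 - T t * e1 t ht - T t * deriv E.h t * hp'
    simpa [E.g_ne_zero t ht, E.h_ne_zero t ht] using this
  obtain ⟨ha, ha'⟩ := eq_zero_of_affine hT e2
  have hα : α = 0 := by linear_combination ha - hp
  have hα' : α' = -1 := by linear_combination -ha' - hp'
  have e3 : ∀ t ∈ E.I, deriv E.ratio t = -b * E.g t := fun t ht => by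
    linear_combination (h t ht).2 - T t * deriv E.ratio t * hp + E.g t * E.ratio t * hα
  have e4 : ∀ t ∈ E.I, E.ratio t = b * T t - b' := fun t ht => by
    refine mul_left_cancel₀ (E.g_ne_zero t ht) ?_
    linear_combination (h' t ht).2 - T t * e3 t ht - T t * deriv E.ratio t * hp'
      + E.g t * E.ratio t * hα'
  have e5 : ∀ t ∈ E.I, deriv E.ratio t = b * E.g t := fun t ht => by
    have : HasDerivAt (fun t => b * T t - b') (b * E.g t) t :=
      ((hT t ht).const_mul b).sub_const b'
    exact (this.congr_of_eventuallyEq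
      (Filter.eventuallyEq_of_mem (E.isOpen_I.mem_nhds ht) e4)).deriv
  intro t ht
  constructor
  · rw [e1 t ht, ha]
    ring
  · linear_combination (e3 t ht + e5 t ht) / 2

/-- Unless `h` and `f / g` are constant, the symmetries form a line modulo `∂_x`. -/
theorem Classifying.exists_multiple (hT : ∀ t ∈ E.I, HasDerivAt T (E.g t) t) (hE : ¬ Flat E)
    {a' α' b' k' : ℝ} (h : Classifying E T a α b k) (hne : a - α ≠ 0 ∨ k ≠ 0)
    (h' : Classifying E T a' α' b' k') :
    ∃ m : ℝ, a' = m * a ∧ α' = m * α ∧ b' = m * b ∧ k' = m * k := by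
  have hD : (a - α) * k' - (a' - α') * k = 0 := by
    -- If the determinant is nonzero, Cramer's rule gives combinations with `(a - α, k)` equal to
    -- `(0, 1)` and `(1, 0)`.
    by_contra hD
    set D := (a - α) * k' - (a' - α') * k with hDdef
    have c1 := h.linear_combination h' (-(a' - α') / D) ((a - α) / D)
    have c2 := h.linear_combination h' (k' / D) (-k / D)
    have k1 : -(a' - α') / D * k + (a - α) / D * k' = 1 := by
      field_simp
      linear_combination -hDdef
    have k2 : k' / D * k + -k / D * k' = 0 := by ring
    rw [k1] at c1
    rw [k2] at c2
    refine hE (flat_of_classifying hT c1 (by ring) c2 ?_)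
    field_simp
    linear_combination -hDdef
  obtain ⟨m, hp, hk⟩ : ∃ m : ℝ, a' - α' = m * (a - α) ∧ k' = m * k := by
    by_cases hp : a - α = 0
    · have hk := hne.resolve_left (not_not.2 hp)
      rw [hp] at hD ⊢
      have : a' - α' = 0 := by simpa [hk] using hD
      exact ⟨k' / k, by rw [this, mul_zero], by field_simp⟩
    · refine ⟨(a' - α') / (a - α), by field_simp, ?_⟩
      field_simp
      linear_combination hD
  -- Subtracting `m` times the first tuple makes `(a - α, k)` zero, so the remaining entries agree
  -- as well.
  obtain ⟨e1, e2, e3, e4⟩ := (h'.linear_combination h 1 (-m)).eq_zero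
    (by linear_combination hp) (by linear_combination hk)
  exact ⟨m, by linear_combination e1, by linear_combination e2, by linear_combination e3, hk⟩

/-- Since `∂_x` is independent and always a symmetry, an extension means a symmetry outside its
span, that is, one with `τ ≠ 0`. -/
theorem hasExtension_iff (hT : ∀ t ∈ E.I, HasDerivAt T (E.g t) t) :
    HasExtension E ↔ ∃ a α b k, Classifying E T a α b k ∧ (a - α ≠ 0 ∨ k ≠ 0) := by
  obtain ⟨t₀, ht₀⟩ := E.nonempty_I
  have indep : ∀ c : Fin [partialX].length → ℝ,
      Set.EqOn (∑ i, c i • [partialX].get i) 0 E.domain → c = 0 := by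
    intro c hc
    have := hc (x := (t₀, 0, 0)) ht₀
    funext i
    fin_cases i
    simpa [partialX] using this
  have span : ∀ v, (∃ c : Fin [partialX].length → ℝ,
      Set.EqOn v (∑ i, c i • [partialX].get i) E.domain) ↔
      ∃ c : ℝ, Set.EqOn v (affineField E T c 0 0 0 0) E.domain := by
    intro v
    constructor
    · rintro ⟨c, hc⟩
      exact ⟨c 0, fun p hp => (hc hp).trans (by simp [affineField, partialX])⟩
    · rintro ⟨c, hc⟩
      exact ⟨fun _ => c, fun p hp => (hc hp).trans (by simp [affineField, partialX])⟩
  rw [HasExtension, IsBasisOfMaxAlgebra, and_iff_left indep]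
  simp only [span, isLieSymmetry_iff_classifying hT]
  constructor
  · intro h
    by_contra! hc
    refine h fun v => ⟨?_, ?_⟩
    · rintro ⟨c, a, α, b, k, hv, hcl⟩
      obtain ⟨hp, hk⟩ := hc a α b k hcl
      obtain ⟨rfl, rfl, rfl, rfl⟩ := hcl.eq_zero hp hk
      exact ⟨c, hv⟩
    · rintro ⟨c, hv⟩
      exact ⟨c, 0, 0, 0, 0, hv, Classifying.zero⟩
  · rintro ⟨a, α, b, k, hcl, hne⟩ h
    obtain ⟨c, hc⟩ := (h (affineField E T 0 a α b k)).1 ⟨0, a, α, b, k, fun _ _ => rfl, hcl⟩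
    have : ∀ t ∈ E.I, (a - α) * T t + k = 0 := fun t ht => by
      have := congrArg Prod.fst (hc (x := (t, 0, 0)) ht)
      simpa [affineField, E.g_ne_zero t ht] using this
    obtain ⟨h1, h2⟩ := eq_zero_of_affine hT this
    exact hne.elim (fun h => h h1) fun h => h h2

/-! ### Bases of the maximal Lie invariance algebra -/

theorem isBasis_pair (hT : ∀ t ∈ E.I, HasDerivAt T (E.g t) t) (hE : ¬ Flat E)
    (h : Classifying E T a α b k) (hne : a - α ≠ 0 ∨ k ≠ 0) {w : VectorField}
    (hw : Set.EqOn w (affineField E T 0 a α b k) E.domain) :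
    IsBasisOfMaxAlgebra E [partialX, w] := by
  have sum : ∀ c : Fin [partialX, w].length → ℝ, ∀ p ∈ E.domain,
      (∑ i, c i • [partialX, w].get i) p
        = affineField E T (c 0) (c 1 * a) (c 1 * α) (c 1 * b) (c 1 * k) p := by
    intro c p hp
    have hs : (∑ i, c i • [partialX, w].get i) = c 0 • partialX + c 1 • w := Fin.sum_univ_two _
    rw [hs, Pi.add_apply, Pi.smul_apply, Pi.smul_apply, hw hp]
    simp only [affineField, partialX, Prod.smul_mk, Prod.mk_add_mk, smul_eq_mul]
    refine Prod.ext ?_ (Prod.ext ?_ ?_) <;> simp only <;> ring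
  refine ⟨fun v => ?_, fun c hc => ?_⟩
  · rw [isLieSymmetry_iff_classifying hT]
    constructor
    · rintro ⟨c, a', α', b', k', hv, h'⟩
      obtain ⟨m, rfl, rfl, rfl, rfl⟩ := h.exists_multiple hT hE hne h'
      exact ⟨![c, m], fun p hp => (hv hp).trans (sum ![c, m] p hp).symm⟩
    · rintro ⟨c, hc⟩
      refine ⟨c 0, c 1 * a, c 1 * α, c 1 * b, c 1 * k, fun p hp => (hc hp).trans (sum c p hp), ?_⟩
      simpa using h.linear_combination Classifying.zero (c 1) 0
  · have e : ∀ t ∈ E.I, affineField E T (c 0) (c 1 * a) (c 1 * α) (c 1 * b) (c 1 * k) (t, 0, 0)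
        = (0, 0, 0) := fun t ht => (sum c (t, 0, 0) ht).symm.trans (hc ht)
    obtain ⟨h1, h2⟩ := eq_zero_of_affine hT (p := c 1 * (a - α)) (q := c 1 * k) fun t ht => by
      have := congrArg Prod.fst (e t ht)
      simp only [affineField, div_eq_zero_iff, E.g_ne_zero t ht, or_false] at this
      linear_combination this
    have hc1 : c 1 = 0 := by
      rcases hne with h | h
      · exact (mul_eq_zero.1 h1).resolve_right h
      · exact (mul_eq_zero.1 h2).resolve_right h
    obtain ⟨t₀, ht₀⟩ := E.nonempty_I
    have hc0 : c 0 = 0 := by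
      have := congrArg (fun z => z.2.1) (e t₀ ht₀)
      simpa [affineField] using this
    funext i
    fin_cases i
    · exact hc0
    · exact hc1

/-- For constant `h` and `f / g = μ` the conditions reduce to `a = 0` and `b = α μ`, so `c`, `α` and
`k` are free. -/
theorem isBasis_triple (hT : ∀ t ∈ E.I, HasDerivAt T (E.g t) t) {μ : ℝ}
    (hh : ∀ t ∈ E.I, deriv E.h t = 0) (hf : ∀ t ∈ E.I, E.ratio t = μ) {w₁ w₂ : VectorField}
    (hw₁ : Set.EqOn w₁ (affineField E T 0 0 0 0 1) E.domain)
    (hw₂ : Set.EqOn w₂ (affineField E T 0 0 (-1) (-μ) 0) E.domain) :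
    IsBasisOfMaxAlgebra E [partialX, w₁, w₂] := by
  have hf' : ∀ t ∈ E.I, deriv E.ratio t = 0 := fun t ht =>
    ((hasDerivAt_const t μ).congr_of_eventuallyEq
      (Filter.eventuallyEq_of_mem (E.isOpen_I.mem_nhds ht) hf)).deriv
  have sum : ∀ c : Fin [partialX, w₁, w₂].length → ℝ, ∀ p ∈ E.domain,
      (∑ i, c i • [partialX, w₁, w₂].get i) p
        = affineField E T (c 0) 0 (-c 2) (-c 2 * μ) (c 1) p := by
    intro c p hp
    have hs : (∑ i, c i • [partialX, w₁, w₂].get i) = c 0 • partialX + c 1 • w₁ + c 2 • w₂ :=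
      Fin.sum_univ_three _
    rw [hs, Pi.add_apply, Pi.add_apply, Pi.smul_apply, Pi.smul_apply, Pi.smul_apply, hw₁ hp, hw₂ hp]
    simp only [affineField, partialX, Prod.smul_mk, Prod.mk_add_mk, smul_eq_mul]
    refine Prod.ext ?_ (Prod.ext ?_ ?_) <;> simp only <;> ring
  refine ⟨fun v => ?_, fun c hc => ?_⟩
  · rw [isLieSymmetry_iff_classifying hT]
    constructor
    · rintro ⟨c, a, α, b, k, hv, h⟩
      obtain ⟨t, ht⟩ := E.nonempty_I
      obtain ⟨e1, e2⟩ := h t ht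
      rw [hh t ht] at e1
      rw [hf' t ht, hf t ht] at e2
      have ha : a = 0 := by
        have : (2 * E.g t * E.h t) * a = 0 := by linear_combination -e1
        simpa [E.g_ne_zero t ht, E.h_ne_zero t ht] using this
      have hb : E.g t * (α * μ - b) = 0 := by linear_combination -e2
      have hb' : b = α * μ := by
        linear_combination -(mul_eq_zero.1 hb).resolve_left (E.g_ne_zero t ht)
      subst ha hb'
      refine ⟨![c, k, -α], fun p hp => (hv hp).trans (Eq.trans ?_ (sum ![c, k, -α] p hp).symm)⟩
      simp
    · rintro ⟨c, hc⟩
      refine ⟨c 0, 0, -c 2, -c 2 * μ, c 1, fun p hp => (hc hp).trans (sum c p hp), fun t ht => ?_⟩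
      rw [hh t ht, hf' t ht, hf t ht]
      constructor <;> ring
  · have e : ∀ t ∈ E.I, affineField E T (c 0) 0 (-c 2) (-c 2 * μ) (c 1) (t, 0, 0)
        = (0, 0, 0) := fun t ht => (sum c (t, 0, 0) ht).symm.trans (hc ht)
    obtain ⟨h2, h1⟩ := eq_zero_of_affine hT (p := c 2) (q := c 1) fun t ht => by
      have := congrArg Prod.fst (e t ht)
      simp only [affineField, div_eq_zero_iff, E.g_ne_zero t ht, or_false] at this
      linear_combination this
    obtain ⟨t₀, ht₀⟩ := E.nonempty_I
    have h0 : c 0 = 0 := by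
      have := congrArg (fun z => z.2.1) (e t₀ ht₀)
      simpa [affineField] using this
    funext i
    fin_cases i
    · exact h0
    · exact h1
    · exact h2

end Classifying

/-! ### The list without equivalence -/

section Rows

variable {E : Equation} {T : ℝ → ℝ} {a α b k : ℝ}

/-- As `Real.log w = Real.log |w|`, this form can be differentiated without distinguishing the sign
of `w`. -/
theorem abs_rpow_eq_exp {w : ℝ} (hw : w ≠ 0) (r : ℝ) : |w| ^ r = Real.exp (r * Real.log w) := by
  rw [Real.rpow_def_of_pos (abs_pos.2 hw), Real.log_abs, mul_comm]

theorem Equation.deriv_eq_of_eqOn (E : Equation) {F G : ℝ → ℝ} (h : ∀ t ∈ E.I, F t = G t)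
    {t d : ℝ} (ht : t ∈ E.I) (hG : HasDerivAt G d t) : deriv F t = d :=
  (hG.congr_of_eventuallyEq (Filter.eventuallyEq_of_mem (E.isOpen_I.mem_nhds ht) h)).deriv

theorem hasDerivAt_log_affine (hT : ∀ t ∈ E.I, HasDerivAt T (E.g t) t) {ε κ t : ℝ}
    (ht : t ∈ E.I) (hw : ε * T t + κ ≠ 0) :
    HasDerivAt (fun s => Real.log (ε * T s + κ)) (ε * E.g t / (ε * T t + κ)) t :=
  (((hT t ht).const_mul ε).add_const κ).log hw

theorem hasDerivAt_exp_log_affine (hT : ∀ t ∈ E.I, HasDerivAt T (E.g t) t) {ε κ t : ℝ}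
    (ht : t ∈ E.I) (hw : ε * T t + κ ≠ 0) (r : ℝ) :
    HasDerivAt (fun s => Real.exp (r * Real.log (ε * T s + κ)))
      (Real.exp (r * Real.log (ε * T t + κ)) * (r * (ε * E.g t / (ε * T t + κ)))) t :=
  ((hasDerivAt_log_affine hT ht hw).const_mul r).exp

theorem hasDerivAt_exp_mul (hT : ∀ t ∈ E.I, HasDerivAt T (E.g t) t) {t : ℝ} (ht : t ∈ E.I)
    (r : ℝ) : HasDerivAt (fun s => Real.exp (r * T s)) (Real.exp (r * T t) * (r * E.g t)) t :=
  ((hT t ht).const_mul r).exp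

theorem sign_sq {ε : ℝ} (hε : ε = 1 ∨ ε = -1) : ε ≠ 0 ∧ ε ^ 2 = 1 := by
  rcases hε with rfl | rfl <;> norm_num

/-- The generator of the symmetries of a row modulo `∂_x`, as the tuple `(a, α, b, k)` of the
parameters of `affineField`. In Case 5, this is one of the two generators. -/
def Row2.datum : Row2 → ℝ × ℝ × ℝ × ℝ
  | case1 ε κ ρ _ _ μ₃ => (ε * ρ, ε * (ρ - 2), ε * (ρ - 2) * μ₃, 2 * κ)
  | case2 ε κ _ μ₂ _ => (ε, 0, -(ε * μ₂), κ)
  | case3 σ _ _ μ₃ => (σ, σ, σ * μ₃, 2)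
  | case4 _ μ₂ _ => (0, 0, -μ₂, 1)
  | case5 _ _ => (0, 0, 0, 1)

theorem Row2.datum_ne {r : Row2} (h : r.Admissible) :
    r.datum.1 - r.datum.2.1 ≠ 0 ∨ r.datum.2.2.2 ≠ 0 := by
  rcases r with ⟨ε, κ, ρ, μ₁, μ₂, μ₃⟩ | ⟨ε, κ, μ₁, μ₂, μ₃⟩ | ⟨σ, μ₁, μ₂, μ₃⟩ | ⟨μ₁, μ₂, μ₃⟩ | ⟨μ₁, μ₃⟩
  · left
    have : ε * ρ - ε * (ρ - 2) = 2 * ε := by ring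
    simpa [datum, this] using (sign_sq h.1).1
  · left
    simpa [datum] using (sign_sq h.1).1
  all_goals right; simp [datum]

theorem ratio_eq_of_f_eq {t X Y : ℝ} (ht : t ∈ E.I) (h : E.f t = E.g t * (X + Y)) :
    E.ratio t = X + Y := by
  rw [Equation.ratio, h, mul_div_cancel_left₀ _ (E.g_ne_zero t ht)]

theorem Row2.coeff_case1 {ε κ ρ μ₁ μ₂ μ₃ : ℝ}
    (h : (case1 ε κ ρ μ₁ μ₂ μ₃).Describes E T) (hT : ∀ t ∈ E.I, HasDerivAt T (E.g t) t) :
    ∀ t ∈ E.I, ε * T t + κ ≠ 0 ∧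
      E.h t = μ₁ * Real.exp (ρ * Real.log (ε * T t + κ)) ∧
      E.ratio t = μ₂ * Real.exp ((ρ - 2) / 2 * Real.log (ε * T t + κ)) + μ₃ ∧
      deriv E.h t = μ₁ * (Real.exp (ρ * Real.log (ε * T t + κ))
        * (ρ * (ε * E.g t / (ε * T t + κ)))) ∧
      deriv E.ratio t = μ₂ * (Real.exp ((ρ - 2) / 2 * Real.log (ε * T t + κ))
        * ((ρ - 2) / 2 * (ε * E.g t / (ε * T t + κ)))) := by
  have hw : ∀ t ∈ E.I, ε * T t + κ ≠ 0 := fun t ht => (h.2 t ht).1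
  have e1 : ∀ t ∈ E.I, E.h t = μ₁ * Real.exp (ρ * Real.log (ε * T t + κ)) := fun t ht => by
    rw [(h.2 t ht).2.2, ← abs_rpow_eq_exp (hw t ht)]
    rfl
  have e2 : ∀ t ∈ E.I, E.ratio t = μ₂ * Real.exp ((ρ - 2) / 2 * Real.log (ε * T t + κ)) + μ₃ :=
    fun t ht => ratio_eq_of_f_eq ht (by
      rw [(h.2 t ht).2.1, ← abs_rpow_eq_exp (hw t ht)]
      simp only [Row2.f]
      ring)
  exact fun t ht => ⟨hw t ht, e1 t ht, e2 t ht,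
    E.deriv_eq_of_eqOn e1 ht ((hasDerivAt_exp_log_affine hT ht (hw t ht) _).const_mul μ₁),
    E.deriv_eq_of_eqOn e2 ht
      (((hasDerivAt_exp_log_affine hT ht (hw t ht) _).const_mul μ₂).add_const μ₃)⟩

theorem Row2.coeff_case2 {ε κ μ₁ μ₂ μ₃ : ℝ}
    (h : (case2 ε κ μ₁ μ₂ μ₃).Describes E T) (hT : ∀ t ∈ E.I, HasDerivAt T (E.g t) t) :
    ∀ t ∈ E.I, ε * T t + κ ≠ 0 ∧
      E.h t = μ₁ * (ε * T t + κ) ^ 2 ∧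
      E.ratio t = μ₂ * Real.log (ε * T t + κ) + μ₃ ∧
      deriv E.h t = μ₁ * (2 * (ε * T t + κ) * (ε * E.g t)) ∧
      deriv E.ratio t = μ₂ * (ε * E.g t / (ε * T t + κ)) := by
  have hw : ∀ t ∈ E.I, ε * T t + κ ≠ 0 := fun t ht => (h.2 t ht).1
  have e1 : ∀ t ∈ E.I, E.h t = μ₁ * (ε * T t + κ) ^ 2 := fun t ht => (h.2 t ht).2.2
  have e2 : ∀ t ∈ E.I, E.ratio t = μ₂ * Real.log (ε * T t + κ) + μ₃ :=
    fun t ht => ratio_eq_of_f_eq ht (by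
      rw [(h.2 t ht).2.1]
      simp only [Row2.f, Real.log_abs]
      ring)
  refine fun t ht => ⟨hw t ht, e1 t ht, e2 t ht, ?_,
    E.deriv_eq_of_eqOn e2 ht
      (((hasDerivAt_log_affine hT ht (hw t ht)).const_mul μ₂).add_const μ₃)⟩
  have := (((((hT t ht).const_mul ε).add_const κ).pow 2).const_mul μ₁)
  exact (E.deriv_eq_of_eqOn e1 ht this).trans (by push_cast; ring)

theorem Row2.coeff_case3 {σ μ₁ μ₂ μ₃ : ℝ}
    (h : (case3 σ μ₁ μ₂ μ₃).Describes E T) (hT : ∀ t ∈ E.I, HasDerivAt T (E.g t) t) :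
    ∀ t ∈ E.I, E.h t = μ₁ * Real.exp (σ * T t) ∧
      E.ratio t = μ₂ * Real.exp (σ / 2 * T t) + μ₃ ∧
      deriv E.h t = μ₁ * (Real.exp (σ * T t) * (σ * E.g t)) ∧
      deriv E.ratio t = μ₂ * (Real.exp (σ / 2 * T t) * (σ / 2 * E.g t)) := by
  have e1 : ∀ t ∈ E.I, E.h t = μ₁ * Real.exp (σ * T t) := fun t ht => (h.2 t ht).2.2
  have e2 : ∀ t ∈ E.I, E.ratio t = μ₂ * Real.exp (σ / 2 * T t) + μ₃ :=
    fun t ht => ratio_eq_of_f_eq ht (by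
      rw [(h.2 t ht).2.1, Row2.f, div_mul_eq_mul_div]
      ring)
  exact fun t ht => ⟨e1 t ht, e2 t ht,
    E.deriv_eq_of_eqOn e1 ht ((hasDerivAt_exp_mul hT ht _).const_mul μ₁),
    E.deriv_eq_of_eqOn e2 ht (((hasDerivAt_exp_mul hT ht _).const_mul μ₂).add_const μ₃)⟩

theorem Row2.coeff_case4 {μ₁ μ₂ μ₃ : ℝ}
    (h : (case4 μ₁ μ₂ μ₃).Describes E T) (hT : ∀ t ∈ E.I, HasDerivAt T (E.g t) t) :
    ∀ t ∈ E.I, E.h t = μ₁ ∧ E.ratio t = μ₂ * T t + μ₃ ∧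
      deriv E.h t = 0 ∧ deriv E.ratio t = μ₂ * E.g t := by
  have e1 : ∀ t ∈ E.I, E.h t = μ₁ := fun t ht => (h.2 t ht).2.2
  have e2 : ∀ t ∈ E.I, E.ratio t = μ₂ * T t + μ₃ :=
    fun t ht => ratio_eq_of_f_eq ht (by
      rw [(h.2 t ht).2.1, Row2.f]
      ring)
  exact fun t ht => ⟨e1 t ht, e2 t ht, E.deriv_eq_of_eqOn e1 ht (hasDerivAt_const t μ₁),
    E.deriv_eq_of_eqOn e2 ht (((hT t ht).const_mul μ₂).add_const μ₃)⟩

theorem Row2.coeff_case5 {μ₁ μ₃ : ℝ} (h : (case5 μ₁ μ₃).Describes E T) :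
    ∀ t ∈ E.I, E.h t = μ₁ ∧ E.ratio t = μ₃ ∧ deriv E.h t = 0 ∧ deriv E.ratio t = 0 := by
  have e1 : ∀ t ∈ E.I, E.h t = μ₁ := fun t ht => (h.2 t ht).2.2
  have e2 : ∀ t ∈ E.I, E.ratio t = μ₃ := fun t ht => by
    rw [Equation.ratio, (h.2 t ht).2.1, Row2.f, mul_div_cancel_right₀ _ (E.g_ne_zero t ht)]
  exact fun t ht => ⟨e1 t ht, e2 t ht, E.deriv_eq_of_eqOn e1 ht (hasDerivAt_const t μ₁),
    E.deriv_eq_of_eqOn e2 ht (hasDerivAt_const t μ₃)⟩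

theorem Row2.Describes.classifying {r : Row2} (h : r.Describes E T)
    (hT : ∀ t ∈ E.I, HasDerivAt T (E.g t) t) :
    Classifying E T r.datum.1 r.datum.2.1 r.datum.2.2.1 r.datum.2.2.2 := by
  intro t ht
  rcases r with ⟨ε, κ, ρ, μ₁, μ₂, μ₃⟩ | ⟨ε, κ, μ₁, μ₂, μ₃⟩ | ⟨σ, μ₁, μ₂, μ₃⟩ | ⟨μ₁, μ₂, μ₃⟩ | ⟨μ₁, μ₃⟩
  · obtain ⟨hw, e1, e2, e3, e4⟩ := coeff_case1 h hT t ht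
    rw [e1, e2, e3, e4]
    simp only [datum]
    constructor <;> field_simp <;> ring
  · obtain ⟨hw, e1, e2, e3, e4⟩ := coeff_case2 h hT t ht
    rw [e1, e2, e3, e4]
    simp only [datum]
    constructor
    · ring
    · field_simp
      ring
  · obtain ⟨e1, e2, e3, e4⟩ := coeff_case3 h hT t ht
    rw [e1, e2, e3, e4]
    simp only [datum]
    constructor <;> ring
  · obtain ⟨e1, e2, e3, e4⟩ := coeff_case4 h hT t ht
    rw [e1, e2, e3, e4]
    simp only [datum]
    constructor <;> ring
  · obtain ⟨e1, e2, e3, e4⟩ := coeff_case5 h t ht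
    rw [e1, e2, e3, e4]
    simp only [datum]
    constructor <;> ring

/-- Outside Case 5, one of the two derivatives is nonzero at every point. In Case 1 this is what
`(ρ, μ₂) ≠ (0, 0)` ensures. -/
theorem Row2.Describes.flat_iff {r : Row2} (h : r.Describes E T)
    (hT : ∀ t ∈ E.I, HasDerivAt T (E.g t) t) : Flat E ↔ ∃ μ₁ μ₃, r = case5 μ₁ μ₃ := by
  constructor
  · intro hE
    obtain ⟨t, ht⟩ := E.nonempty_I
    obtain ⟨d1, d2⟩ := hE t ht
    have hg := E.g_ne_zero t ht
    rcases r with ⟨ε, κ, ρ, μ₁, μ₂, μ₃⟩ | ⟨ε, κ, μ₁, μ₂, μ₃⟩ | ⟨σ, μ₁, μ₂, μ₃⟩ | ⟨μ₁, μ₂, μ₃⟩ |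
      ⟨μ₁, μ₃⟩
    · obtain ⟨hw, -, -, e3, e4⟩ := coeff_case1 h hT t ht
      obtain ⟨hε, h1, h2⟩ := h.1
      have h0 := (sign_sq hε).1
      have hρ : ρ = 0 := by simpa [e3, h0, h1, hg, hw] using d1
      subst hρ
      have hμ : μ₂ = 0 := by simpa [e4, h0, hg, hw] using d2
      exact absurd (by rw [hμ]) h2
    · obtain ⟨hw, -, -, e3, e4⟩ := coeff_case2 h hT t ht
      obtain ⟨hε, h1⟩ := h.1
      have h0 := (sign_sq hε).1
      simp [e3, h0, h1, hg, hw] at d1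
    · obtain ⟨-, -, e3, -⟩ := coeff_case3 h hT t ht
      obtain ⟨h1, h2⟩ := h.1
      simp [e3, h1, h2, hg] at d1
    · obtain ⟨-, -, -, e4⟩ := coeff_case4 h hT t ht
      obtain ⟨h1, h2⟩ := h.1
      simp [e4, h2, hg] at d2
    · exact ⟨_, _, rfl⟩
  · rintro ⟨μ₁, μ₃, rfl⟩ t ht
    exact (coeff_case5 h t ht).2.2

theorem Row2.Describes.isBasis {r : Row2} (h : r.Describes E T)
    (hT : ∀ t ∈ E.I, HasDerivAt T (E.g t) t) : IsBasisOfMaxAlgebra E (r.basis E.g T) := by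
  have hc := h.classifying hT
  have hn := datum_ne h.1
  have hf := h.flat_iff hT
  rcases r with ⟨ε, κ, ρ, μ₁, μ₂, μ₃⟩ | ⟨ε, κ, μ₁, μ₂, μ₃⟩ | ⟨σ, μ₁, μ₂, μ₃⟩ | ⟨μ₁, μ₂, μ₃⟩ | ⟨μ₁, μ₃⟩
  · refine isBasis_pair hT (by simp [hf]) hc hn fun p hp => ?_
    simp only [datum, affineField]
    refine Prod.ext ?_ (Prod.ext ?_ ?_) <;> simp only <;> ring
  · refine isBasis_pair hT (by simp [hf]) hc hn fun p hp => ?_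
    simp only [datum, affineField]
    refine Prod.ext ?_ (Prod.ext ?_ ?_) <;> simp only <;> ring
  · refine isBasis_pair hT (by simp [hf]) hc hn fun p hp => ?_
    simp only [datum, affineField]
    refine Prod.ext ?_ (Prod.ext ?_ ?_) <;> simp only <;> ring
  · refine isBasis_pair hT (by simp [hf]) hc hn fun p hp => ?_
    simp only [datum, affineField]
    refine Prod.ext ?_ (Prod.ext ?_ ?_) <;> simp only <;> ring
  · refine isBasis_triple hT (μ := μ₃) (fun t ht => (coeff_case5 h t ht).2.2.1)
      (fun t ht => (coeff_case5 h t ht).2.1) (fun p hp => ?_) fun p hp => ?_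
    · simp only [affineField]
      refine Prod.ext ?_ (Prod.ext ?_ ?_) <;> simp only <;> ring
    · simp only [affineField]
      refine Prod.ext ?_ (Prod.ext ?_ ?_) <;> simp only <;> ring

/-! ### Solution of the classifying conditions -/

theorem exists_eq_mul_exp {y q Q : ℝ → ℝ} (hQ : ∀ t ∈ E.I, HasDerivAt Q (q t) t)
    (hy : ∀ t ∈ E.I, HasDerivAt y (y t * q t) t) :
    ∃ C, ∀ t ∈ E.I, y t = C * Real.exp (Q t) := by
  obtain ⟨C, hC⟩ := is_const_on_I E (F := fun t => y t * Real.exp (-Q t)) fun t ht =>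
    ((hy t ht).mul (hQ t ht).neg.exp).congr_deriv (by simp only [Pi.neg_apply]; ring)
  exact ⟨C, fun t ht => by rw [← hC t ht, mul_assoc, ← Real.exp_add, neg_add_cancel, Real.exp_zero,
    mul_one]⟩

/-- At a zero of the affine factor, the derivative of the product is `p g y`, which must vanish too.
-/
theorem eq_zero_of_affine_mul (hT : ∀ t ∈ E.I, HasDerivAt T (E.g t) t) {p q : ℝ} (hp : p ≠ 0)
    {y : ℝ → ℝ} (hy : ∀ t ∈ E.I, DifferentiableAt ℝ y t)
    (h : ∀ t ∈ E.I, (p * T t + q) * y t = 0) : ∀ t ∈ E.I, y t = 0 := by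
  intro t ht
  have h1 := (((hT t ht).const_mul p).add_const q).mul (hy t ht).hasDerivAt
  have h2 : HasDerivAt ((fun s => p * T s + q) * y) 0 t := (hasDerivAt_const t (0 : ℝ)).congr_of_eventuallyEq
    (Filter.eventuallyEq_of_mem (E.isOpen_I.mem_nhds ht) h)
  have h3 := h1.unique h2
  rcases mul_eq_zero.1 (h t ht) with h0 | h0
  · rw [h0, zero_mul, add_zero] at h3
    simpa [hp, E.g_ne_zero t ht] using h3
  · exact h0

theorem exists_case5 {μ₃ : ℝ} (hh : ∀ t ∈ E.I, deriv E.h t = 0)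
    (hf : ∀ t ∈ E.I, E.ratio t = μ₃) : ∃ r : Row2, r.Describes E T := by
  obtain ⟨C, hC⟩ := is_const_on_I E fun t ht => (E.hasDerivAt_h ht).congr_deriv (hh t ht)
  obtain ⟨t₀, ht₀⟩ := E.nonempty_I
  refine ⟨.case5 C μ₃, (hC t₀ ht₀) ▸ E.h_ne_zero t₀ ht₀, fun t ht => ⟨trivial, ?_, hC t ht⟩⟩
  rw [E.f_eq ht, hf t ht, Row2.f, mul_comm]

/-- At a zero of `θ = (a - α) T + k` the condition on `h` forces `a = 0`. Then `θ h' = 0`, while `θ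
(f / g - b / α)` is constant and vanishes at that zero. Both cofactors vanish identically, which is
Case 5. -/
theorem Classifying.exists_row_of_vanishing (hT : ∀ t ∈ E.I, HasDerivAt T (E.g t) t)
    (h : Classifying E T a α b k) (hp : a - α ≠ 0) {t₁ : ℝ} (ht₁ : t₁ ∈ E.I)
    (h₁ : (a - α) * T t₁ + k = 0) : ∃ r : Row2, r.Describes E T := by
  have ha : a = 0 := by
    have : (2 * E.g t₁ * E.h t₁) * a = 0 := by
      linear_combination deriv E.h t₁ * h₁ - (h t₁ ht₁).1
    simpa [E.g_ne_zero t₁ ht₁, E.h_ne_zero t₁ ht₁] using this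
  subst ha
  have hα : α ≠ 0 := by simpa using hp
  obtain ⟨C, hC⟩ := is_const_on_I E
    (F := fun t => ((0 - α) * T t + k) * (E.ratio t - b / α)) fun t ht => by
      refine ((((hT t ht).const_mul (0 - α)).add_const k).mul
        ((E.hasDerivAt_ratio ht).sub_const (b / α))).congr_deriv ?_
      rw [(h t ht).2]
      field_simp
      ring
  have hC0 : C = 0 := by rw [← hC t₁ ht₁, h₁, zero_mul]
  refine exists_case5 (μ₃ := b / α) ?_ fun t ht => sub_eq_zero.1 ?_
  · refine eq_zero_of_affine_mul hT (p := 0 - α) (q := k) hp (fun t ht => ?_) fun t ht => ?_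
    · exact differentiableAt_of_contDiffOn E.isOpen_I
        ((contDiffOn_infty_iff_deriv_of_isOpen E.isOpen_I).1 E.smooth_h).2 ht
    · linear_combination (h t ht).1
  · exact eq_zero_of_affine_mul hT (p := 0 - α) (q := k) hp (y := fun t => E.ratio t - b / α)
      (fun t ht => (E.hasDerivAt_ratio ht).differentiableAt.sub_const _)
      (fun t ht => (hC t ht).trans hC0) t ht

/-- Dividing by `a - α` gives `ε = 1`, `κ = k / (a - α)` and `ρ = 2 a / (a - α)`. For `α ≠ 0`, the
function `f / g - b / α` is a power with exponent `α / (a - α) = (ρ - 2) / 2`. For `α = 0` one has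
`ρ = 2`, and `f / g` is logarithmic. -/
theorem Classifying.exists_row_of_ne (hT : ∀ t ∈ E.I, HasDerivAt T (E.g t) t)
    (h : Classifying E T a α b k) (hp : a - α ≠ 0)
    (hθ : ∀ t ∈ E.I, (a - α) * T t + k ≠ 0) : ∃ r : Row2, r.Describes E T := by
  obtain ⟨t₀, ht₀⟩ := E.nonempty_I
  have hw : ∀ t ∈ E.I, 1 * T t + k / (a - α) ≠ 0 := fun t ht h0 => hθ t ht (by
    field_simp at h0
    linear_combination h0)
  have hL := fun t ht => hasDerivAt_log_affine hT ht (hw t ht)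
  have hwθ : ∀ t, (a - α) * T t + k = (a - α) * (1 * T t + k / (a - α)) := fun t => by
    field_simp
  obtain ⟨C, hC⟩ := exists_eq_mul_exp (E := E) (y := E.h)
    (fun t ht => (hL t ht).const_mul (2 * a / (a - α))) fun t ht => by
      refine (E.hasDerivAt_h ht).congr_deriv (mul_left_cancel₀ (hθ t ht) ?_)
      rw [(h t ht).1, hwθ]
      have := hw t ht
      generalize 1 * T t + k / (a - α) = w at this ⊢
      field_simp
  have hC0 : C ≠ 0 := by
    rintro rfl
    exact E.h_ne_zero t₀ ht₀ (by rw [hC t₀ ht₀, zero_mul])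
  by_cases hα : α = 0
  · subst hα
    obtain ⟨D, hD⟩ := is_const_on_I E
      (F := fun t => E.ratio t + b / (a - 0) * Real.log (1 * T t + k / (a - 0))) fun t ht => by
        refine ((E.hasDerivAt_ratio ht).add ((hL t ht).const_mul (b / (a - 0)))).congr_deriv ?_
        refine mul_left_cancel₀ (hθ t ht) ?_
        rw [mul_add, (h t ht).2, hwθ]
        have := hw t ht
        generalize 1 * T t + k / (a - 0) = w at this ⊢
        field_simp
        ring
    refine ⟨.case2 1 (k / (a - 0)) C (-(b / (a - 0))) D, ⟨.inl rfl, hC0⟩, fun t ht =>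
      ⟨hw t ht, ?_, ?_⟩⟩
    · rw [E.f_eq ht]
      simp only [Row2.f, Real.log_abs]
      linear_combination E.g t * hD t ht
    · rw [hC t ht, Row2.h, ← abs_rpow_eq_exp (hw t ht)]
      have : 2 * a / (a - 0) = (2 : ℕ) := by
        rw [sub_zero] at hp ⊢
        field_simp
        norm_num
      rw [this, Real.rpow_natCast, sq_abs]
  · obtain ⟨D, hD⟩ := exists_eq_mul_exp (E := E) (y := fun t => E.ratio t - b / α)
      (fun t ht => (hL t ht).const_mul ((2 * a / (a - α) - 2) / 2)) fun t ht => by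
        refine ((E.hasDerivAt_ratio ht).sub_const _).congr_deriv (mul_left_cancel₀ (hθ t ht) ?_)
        rw [(h t ht).2, hwθ]
        have := hw t ht
        generalize 1 * T t + k / (a - α) = w at this ⊢
        field_simp
        ring
    have hh : ∀ t ∈ E.I, E.h t = C * |1 * T t + k / (a - α)| ^ (2 * a / (a - α)) := fun t ht => by
      rw [hC t ht, abs_rpow_eq_exp (hw t ht)]
    have hf : ∀ t ∈ E.I, E.ratio t
        = D * |1 * T t + k / (a - α)| ^ ((2 * a / (a - α) - 2) / 2) + b / α := fun t ht => by
      rw [abs_rpow_eq_exp (hw t ht)]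
      linear_combination hD t ht
    -- This excluded pair of Case 1 has constant `h` and `f / g`, so it belongs to Case 5.
    by_cases h0 : (2 * a / (a - α), D) = (0, 0)
    · simp only [Prod.mk.injEq] at h0
      refine exists_case5 (μ₃ := b / α) (fun t ht => ?_) fun t ht => ?_
      · refine E.deriv_eq_of_eqOn (G := fun _ => C) (fun s hs => ?_) ht (hasDerivAt_const t C)
        rw [hh s hs, h0.1, Real.rpow_zero, mul_one]
      · rw [hf t ht, h0.2, zero_mul, zero_add]
    · refine ⟨.case1 1 (k / (a - α)) (2 * a / (a - α)) C D (b / α), ⟨.inl rfl, hC0, h0⟩,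
        fun t ht => ⟨hw t ht, ?_, hh t ht⟩⟩
      rw [E.f_eq ht, Row2.f, hf t ht]
      ring

/-- With `τ g = k` constant, `h` and `f / g` satisfy linear equations with constant coefficients in
the variable `T`: exponentials for `a ≠ 0`, and constant `h` with affine `f / g` for `a = 0`. -/
theorem Classifying.exists_row_of_eq (hT : ∀ t ∈ E.I, HasDerivAt T (E.g t) t)
    (h : Classifying E T a α b k) (hp : a - α = 0) (hk : k ≠ 0) :
    ∃ r : Row2, r.Describes E T := by
  obtain ⟨t₀, ht₀⟩ := E.nonempty_I
  obtain rfl : a = α := sub_eq_zero.1 hp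
  have hd : ∀ t ∈ E.I, deriv E.h t = 2 * a / k * E.g t * E.h t ∧
      deriv E.ratio t = E.g t * (a * E.ratio t - b) / k := fun t ht => by
    obtain ⟨e1, e2⟩ := h t ht
    constructor
    · field_simp
      linear_combination e1
    · field_simp
      linear_combination e2
  by_cases ha : a = 0
  · subst ha
    obtain ⟨D, hD⟩ := is_const_on_I E (F := fun t => E.ratio t + b / k * T t) fun t ht => by
      refine ((E.hasDerivAt_ratio ht).add ((hT t ht).const_mul (b / k))).congr_deriv ?_
      rw [(hd t ht).2]
      ring
    have hh : ∀ t ∈ E.I, deriv E.h t = 0 := fun t ht => by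
      rw [(hd t ht).1]
      ring
    by_cases hb : b = 0
    · exact exists_case5 (μ₃ := D) hh fun t ht => by simpa [hb] using hD t ht
    · obtain ⟨C, hC⟩ := is_const_on_I E fun t ht => (E.hasDerivAt_h ht).congr_deriv (hh t ht)
      refine ⟨.case4 C (-(b / k)) D, ⟨hC t₀ ht₀ ▸ E.h_ne_zero t₀ ht₀,
        neg_ne_zero.2 (div_ne_zero hb hk)⟩, fun t ht => ⟨trivial, ?_, hC t ht⟩⟩
      rw [E.f_eq ht, Row2.f]
      linear_combination E.g t * hD t ht
  · obtain ⟨C, hC⟩ := exists_eq_mul_exp (E := E) (y := E.h)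
      (fun t ht => (hT t ht).const_mul (2 * a / k)) fun t ht => by
        refine (E.hasDerivAt_h ht).congr_deriv ?_
        rw [(hd t ht).1]
        ring
    have hC0 : C ≠ 0 := by
      rintro rfl
      exact E.h_ne_zero t₀ ht₀ (by rw [hC t₀ ht₀, zero_mul])
    obtain ⟨D, hD⟩ := exists_eq_mul_exp (E := E) (y := fun t => E.ratio t - b / a)
      (fun t ht => (hT t ht).const_mul (a / k)) fun t ht => by
        refine ((E.hasDerivAt_ratio ht).sub_const _).congr_deriv ?_
        rw [(hd t ht).2]
        field_simp
    refine ⟨.case3 (2 * a / k) C D (b / a), ⟨hC0, by positivity⟩,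
      fun t ht => ⟨trivial, ?_, hC t ht⟩⟩
    rw [E.f_eq ht]
    simp only [Row2.f, show 2 * a / k * T t / 2 = a / k * T t by ring]
    linear_combination E.g t * hD t ht

theorem hasExtension_iff_row2 (hT : ∀ t ∈ E.I, HasDerivAt T (E.g t) t) :
    HasExtension E ↔ ∃ r : Row2, r.Describes E T := by
  rw [hasExtension_iff hT]
  constructor
  · rintro ⟨a, α, b, k, h, hne⟩
    by_cases hp : a - α = 0
    · exact h.exists_row_of_eq hT hp (hne.resolve_left (not_not.2 hp))
    · by_cases hθ : ∀ t ∈ E.I, (a - α) * T t + k ≠ 0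
      · exact h.exists_row_of_ne hT hp hθ
      · push Not at hθ
        obtain ⟨t₁, ht₁, h₁⟩ := hθ
        exact h.exists_row_of_vanishing hT hp ht₁ h₁
  · rintro ⟨r, h⟩
    exact ⟨_, _, _, _, h.classifying hT, Row2.datum_ne h.1⟩

end Rows

/-! ### Equivalence transformations -/

section Equivalence

variable {E E' : Equation} {T : ℝ → ℝ}

theorem Equation.exists_antiderivative (E : Equation) :
    ∃ T : ℝ → ℝ, ∀ t ∈ E.I, HasDerivAt T (E.g t) t := by
  obtain ⟨t₀, ht₀⟩ := E.nonempty_I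
  refine ⟨fun t => ∫ s in t₀..t, E.g s, fun t ht => ?_⟩
  have hc := E.smooth_g.continuousOn
  exact intervalIntegral.integral_hasDerivAt_right
    ((hc.mono (E.ordConnected_I.uIcc_subset ht₀ ht)).intervalIntegrable)
    (hc.stronglyMeasurableAtFilter E.isOpen_I t ht) (hc.continuousAt (E.isOpen_I.mem_nhds ht))

theorem EquivTransformation.hasDerivAt (hI : IsOpen E.I) (Φ : EquivTransformation E.I) {t : ℝ}
    (ht : t ∈ E.I) : HasDerivAt Φ.T (deriv Φ.T t) t :=
  (differentiableAt_of_contDiffOn hI Φ.smooth_T ht).hasDerivAt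

theorem EquivTransformation.injOn (Φ : EquivTransformation E.I) : Set.InjOn Φ.T E.I := by
  have key : ∀ s ∈ E.I, ∀ t ∈ E.I, s < t → Φ.T s ≠ Φ.T t := by
    intro s hs t ht hst heq
    have hsub : Set.Icc s t ⊆ E.I := E.ordConnected_I.out hs ht
    obtain ⟨c, hc, hc0⟩ := exists_deriv_eq_zero hst (Φ.smooth_T.continuousOn.mono hsub) heq
    exact Φ.deriv_T_ne_zero c (hsub (Set.Ioo_subset_Icc_self hc)) hc0
  intro s hs t ht heq
  rcases lt_trichotomy s t with h | h | h
  · exact absurd heq (key s hs t ht h)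
  · exact h
  · exact absurd heq.symm (key t ht s hs h)

theorem EquivTransformation.hasStrictDerivAt (Φ : EquivTransformation E.I) {t : ℝ} (ht : t ∈ E.I) :
    HasStrictDerivAt Φ.T (deriv Φ.T t) t :=
  (Φ.smooth_T.contDiffAt (E.isOpen_I.mem_nhds ht)).hasStrictDerivAt (by simp)

theorem EquivTransformation.isOpen_image (Φ : EquivTransformation E.I) :
    IsOpen (Φ.T '' E.I) := by
  rw [isOpen_iff_mem_nhds]
  rintro _ ⟨t, ht, rfl⟩
  rw [← (Φ.hasStrictDerivAt ht).map_nhds_eq (Φ.deriv_T_ne_zero t ht)]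
  exact Filter.image_mem_map (E.isOpen_I.mem_nhds ht)

/-- Near each point the global inverse agrees with the smooth local inverse, by injectivity. -/
theorem EquivTransformation.exists_inverse (Φ : EquivTransformation E.I) :
    ∃ S : ℝ → ℝ, (∀ t ∈ E.I, S (Φ.T t) = t) ∧ ContDiffOn ℝ ∞ S (Φ.T '' E.I) := by
  refine ⟨Function.invFunOn Φ.T E.I, fun t ht => Φ.injOn.leftInvOn_invFunOn ht, ?_⟩
  rintro _ ⟨t, ht, rfl⟩
  refine ContDiffAt.contDiffWithinAt ?_
  have hs := (Φ.smooth_T.contDiffAt (E.isOpen_I.mem_nhds ht))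
  let A : ℝ ≃L[ℝ] ℝ := ContinuousLinearEquiv.unitsEquivAut ℝ (Units.mk0 _ (Φ.deriv_T_ne_zero t ht))
  have hA : HasFDerivAt Φ.T (A : ℝ →L[ℝ] ℝ) t := by
    refine (Φ.hasStrictDerivAt ht).hasDerivAt.hasFDerivAt.congr_fderiv ?_
    ext
    simp [A]
  refine (hs.to_localInverse hA (by simp)).congr_of_eventuallyEq ?_
  refine HasStrictFDerivAt.localInverse_unique _ ?_
  filter_upwards [E.isOpen_I.mem_nhds ht] with s hs using Φ.injOn.leftInvOn_invFunOn hs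

theorem EquivTransformation.exists_maps (Φ : EquivTransformation E.I) : ∃ E', Φ.Maps E' := by
  obtain ⟨S, hS, hSs⟩ := Φ.exists_inverse
  obtain ⟨h1, h3⟩ := mul_ne_zero_iff.1 Φ.δ_ne_zero
  have hmap : Set.MapsTo S (Φ.T '' E.I) E.I := by
    rintro _ ⟨t, ht, rfl⟩
    rwa [hS t ht]
  have hT' : ContDiffOn ℝ ∞ (deriv Φ.T) E.I :=
    ((contDiffOn_infty_iff_deriv_of_isOpen E.isOpen_I).1 Φ.smooth_T).2
  have hq : ContDiffOn ℝ ∞ (fun t => Φ.δ₁ / (deriv Φ.T t * Φ.δ₃)) E.I :=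
    contDiffOn_const.div (hT'.mul contDiffOn_const) fun t ht =>
      mul_ne_zero (Φ.deriv_T_ne_zero t ht) h3
  let E' : Equation :=
    { I := Φ.T '' E.I
      f := fun y => Φ.δ₁ / (deriv Φ.T (S y) * Φ.δ₃) * (Φ.δ₃ * E.f (S y) - Φ.δ₄ * E.g (S y))
      g := fun y => Φ.δ₁ / (deriv Φ.T (S y) * Φ.δ₃) * E.g (S y)
      h := fun y => Φ.δ₁ ^ 2 * E.h (S y)
      isOpen_I := Φ.isOpen_image
      ordConnected_I := (E.ordConnected_I.isPreconnected.image _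
        Φ.smooth_T.continuousOn).ordConnected
      nonempty_I := E.nonempty_I.image _
      smooth_f := (hq.mul ((contDiffOn_const.mul E.smooth_f).sub
        (contDiffOn_const.mul E.smooth_g))).comp hSs hmap
      smooth_g := (hq.mul E.smooth_g).comp hSs hmap
      smooth_h := (contDiffOn_const.mul E.smooth_h).comp hSs hmap
      g_ne_zero := fun y hy => mul_ne_zero (div_ne_zero h1
        (mul_ne_zero (Φ.deriv_T_ne_zero _ (hmap hy)) h3)) (E.g_ne_zero _ (hmap hy))
      h_ne_zero := fun y hy => mul_ne_zero (pow_ne_zero 2 h1) (E.h_ne_zero _ (hmap hy)) }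
  refine ⟨E', rfl, fun t ht => ?_⟩
  refine ⟨?_, ?_, ?_⟩ <;> simp only [E', hS t ht]

/-- The choice `δ₃ = δ / A` is the one that makes the new `g` equal to `1`. -/
theorem exists_equiv_affine (hT : ∀ t ∈ E.I, HasDerivAt T (E.g t) t) {A δ : ℝ} (hA : A ≠ 0)
    (hδ : δ ≠ 0) (B δ₄ : ℝ) : ∃ E', GEquiv E E' ∧ ∀ y ∈ E'.I, ∃ t ∈ E.I, y = A * T t + B ∧
      E'.f y = δ / A * E.ratio t - δ₄ ∧ E'.g y = 1 ∧ E'.h y = δ ^ 2 * E.h t := by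
  have hd : ∀ t ∈ E.I, deriv (fun t => A * T t + B) t = A * E.g t := fun t ht =>
    (((hT t ht).const_mul A).add_const B).deriv
  let Φ : EquivTransformation E.I :=
    { T := fun t => A * T t + B
      δ₁ := δ
      δ₂ := 0
      δ₃ := δ / A
      δ₄ := δ₄
      smooth_T := (contDiffOn_const.mul (contDiffOn_of_deriv_g hT)).add contDiffOn_const
      deriv_T_ne_zero := fun t ht => by
        rw [hd t ht]
        exact mul_ne_zero hA (E.g_ne_zero t ht)
      δ_ne_zero := mul_ne_zero hδ (div_ne_zero hδ hA) }
  obtain ⟨E', hI, hE'⟩ := Φ.exists_maps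
  refine ⟨E', ⟨Φ, hI, hE'⟩, fun y hy => ?_⟩
  rw [← hI] at hy
  obtain ⟨t, ht, rfl⟩ := hy
  obtain ⟨e1, e2, e3⟩ := hE' t ht
  have hg := E.g_ne_zero t ht
  refine ⟨t, ht, rfl, ?_, ?_, e3⟩
  · rw [e1, E.f_eq ht]
    simp only [Φ, hd t ht]
    field_simp
  · rw [e2]
    simp only [Φ, hd t ht]
    field_simp

theorem EquivTransformation.Maps.ratio_eq {Φ : EquivTransformation E.I} (h : Φ.Maps E') :
    ∀ t ∈ E.I, E'.ratio (Φ.T t) = Φ.δ₃ * E.ratio t - Φ.δ₄ := by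
  intro t ht
  obtain ⟨e1, e2, -⟩ := h.2 t ht
  obtain ⟨h1, h3⟩ := mul_ne_zero_iff.1 Φ.δ_ne_zero
  have hT := Φ.deriv_T_ne_zero t ht
  have hg := E.g_ne_zero t ht
  rw [Equation.ratio, e1, e2, E.f_eq ht]
  field_simp

theorem EquivTransformation.Maps.mem {Φ : EquivTransformation E.I} (h : Φ.Maps E') {t : ℝ}
    (ht : t ∈ E.I) : Φ.T t ∈ E'.I := h.1 ▸ Set.mem_image_of_mem _ ht

theorem EquivTransformation.Maps.deriv_eq {Φ : EquivTransformation E.I} (h : Φ.Maps E') :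
    ∀ t ∈ E.I, deriv E'.h (Φ.T t) * deriv Φ.T t = Φ.δ₁ ^ 2 * deriv E.h t ∧
      deriv E'.ratio (Φ.T t) * deriv Φ.T t = Φ.δ₃ * deriv E.ratio t := by
  intro t ht
  have hT := Φ.hasDerivAt E.isOpen_I ht
  constructor
  · refine ((E'.hasDerivAt_h (h.mem ht)).comp t hT).deriv.symm.trans ?_
    exact E.deriv_eq_of_eqOn (fun s hs => (h.2 s hs).2.2) ht ((E.hasDerivAt_h ht).const_mul _)
  · refine ((E'.hasDerivAt_ratio (h.mem ht)).comp t hT).deriv.symm.trans ?_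
    exact E.deriv_eq_of_eqOn h.ratio_eq ht (((E.hasDerivAt_ratio ht).const_mul _).sub_const _)

theorem EquivTransformation.Maps.flat_iff {Φ : EquivTransformation E.I} (h : Φ.Maps E') :
    Flat E ↔ Flat E' := by
  obtain ⟨h1, h3⟩ := mul_ne_zero_iff.1 Φ.δ_ne_zero
  constructor
  · intro hE y hy
    rw [← h.1] at hy
    obtain ⟨t, ht, rfl⟩ := hy
    obtain ⟨e1, e2⟩ := h.deriv_eq t ht
    rw [(hE t ht).1] at e1
    rw [(hE t ht).2] at e2
    simpa [Φ.deriv_T_ne_zero t ht] using And.intro e1 e2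
  · intro hE t ht
    obtain ⟨e1, e2⟩ := h.deriv_eq t ht
    rw [(hE _ (h.mem ht)).1] at e1
    rw [(hE _ (h.mem ht)).2] at e2
    simpa [h1, h3] using And.intro e1 e2

theorem EquivTransformation.Maps.deriv_T {Φ : EquivTransformation E.I} (h : Φ.Maps E')
    (hg : ∀ t ∈ E'.I, E'.g t = 1) : ∀ t ∈ E.I, Φ.δ₃ * deriv Φ.T t = Φ.δ₁ * E.g t := by
  intro t ht
  obtain ⟨-, e2, -⟩ := h.2 t ht
  obtain ⟨h1, h3⟩ := mul_ne_zero_iff.1 Φ.δ_ne_zero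
  have hT := Φ.deriv_T_ne_zero t ht
  rw [hg _ (h.mem ht)] at e2
  field_simp at e2
  linear_combination e2

theorem EquivTransformation.Maps.hasDerivAt {Φ : EquivTransformation E.I} (h : Φ.Maps E')
    (hg : ∀ t ∈ E'.I, E'.g t = 1) :
    ∀ t ∈ E.I, HasDerivAt (fun s => Φ.δ₃ / Φ.δ₁ * Φ.T s) (E.g t) t := by
  intro t ht
  obtain ⟨h1, h3⟩ := mul_ne_zero_iff.1 Φ.δ_ne_zero
  refine ((Φ.hasDerivAt E.isOpen_I ht).const_mul _).congr_deriv ?_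
  field_simp
  linear_combination h.deriv_T hg t ht

/-- The pullback of a symmetry. Substituting `u' = δ₃ u + δ₄` in `α u' + b` and dividing by `δ₃`
gives the new `b`; `k` is rescaled with the antiderivative. -/
theorem EquivTransformation.Maps.classifying {Φ : EquivTransformation E.I} (h : Φ.Maps E')
    (hg : ∀ t ∈ E'.I, E'.g t = 1) {a α b k : ℝ} (hc : Classifying E' id a α b k) :
    Classifying E (fun s => Φ.δ₃ / Φ.δ₁ * Φ.T s) a α ((α * Φ.δ₄ + b) / Φ.δ₃)
      (Φ.δ₃ / Φ.δ₁ * k) := by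
  intro t ht
  obtain ⟨h1, h3⟩ := mul_ne_zero_iff.1 Φ.δ_ne_zero
  obtain ⟨d1, d2⟩ := h.deriv_eq t ht
  obtain ⟨e1, e2⟩ := hc _ (h.mem ht)
  have hT' := h.deriv_T hg t ht
  rw [hg _ (h.mem ht), (h.2 t ht).2.2] at e1
  rw [hg _ (h.mem ht), h.ratio_eq t ht] at e2
  simp only [id] at e1 e2
  constructor
  · field_simp
    refine mul_left_cancel₀ (pow_ne_zero 2 h1) ?_
    linear_combination Φ.δ₃ * deriv Φ.T t * e1 - Φ.δ₃ * ((a - α) * Φ.T t + k) * d1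
      + 2 * a * Φ.δ₁ ^ 2 * E.h t * hT'
  · refine mul_left_cancel₀ h1 ?_
    field_simp
    linear_combination Φ.δ₃ * deriv Φ.T t * e2 - Φ.δ₃ * ((a - α) * Φ.T t + k) * d2
      + (α * (Φ.δ₃ * E.ratio t - Φ.δ₄) - b) * hT'

theorem Classifying.shift {T' : ℝ → ℝ} {a α b k e : ℝ} (h : Classifying E T a α b k)
    (he : ∀ t ∈ E.I, T t = T' t + e) : Classifying E T' a α b (k + (a - α) * e) := by
  intro t ht
  obtain ⟨e1, e2⟩ := h t ht
  rw [he t ht] at e1 e2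
  exact ⟨by linear_combination e1, by linear_combination e2⟩

end Equivalence

/-! ### The list up to equivalence -/

section List

variable {E E' : Equation} {T : ℝ → ℝ}

/-- A row of the list up to equivalence, as a row of the list without equivalence. -/
def Row1.toRow2 : Row1 → Row2
  | case1 ε ρ l => .case1 1 0 ρ ε l 0
  | case2 ε => .case2 1 0 ε 1 0
  | case3 ε l => .case3 1 ε l 0
  | case4 ε => .case4 ε 1 0
  | case5 ε => .case5 ε 0

theorem hasDerivAt_id_of_g_one (hg : ∀ t ∈ E.I, E.g t = 1) :
    ∀ t ∈ E.I, HasDerivAt id (E.g t) t := fun t ht => by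
  rw [hg t ht]
  exact hasDerivAt_id t

theorem Row1.Describes.g_eq {r : Row1} (h : r.Describes E) : ∀ t ∈ E.I, E.g t = 1 :=
  fun t ht => (h.2.2 t ht).2.1

theorem eps_ne_zero {ε : ℝ} (h : ε = 1 ∨ ε = -1) : ε ≠ 0 := (sign_sq h).1

theorem Row1.Describes.toRow2 {r : Row1} (h : r.Describes E) : r.toRow2.Describes E id := by
  obtain ⟨hr, hI, he⟩ := h
  rcases r with ⟨ε, ρ, l⟩ | ⟨ε⟩ | ⟨ε, l⟩ | ⟨ε⟩ | ⟨ε⟩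
  · refine ⟨⟨.inl rfl, eps_ne_zero hr.1, hr.2⟩, fun t ht => ?_⟩
    obtain ⟨e1, e2, e3⟩ := he t ht
    have h0 : 0 < t := hI ht
    simp [Row1.toRow2, Row2.range, Row2.f, Row2.h, e1, e2, e3, f, Row1.h, h0.ne', abs_of_pos h0]
  · refine ⟨⟨.inl rfl, hr⟩, fun t ht => ?_⟩
    obtain ⟨e1, e2, e3⟩ := he t ht
    have h0 : 0 < t := hI ht
    simp [Row1.toRow2, Row2.range, Row2.f, Row2.h, e1, e2, e3, f, Row1.h, h0.ne']
  · refine ⟨⟨eps_ne_zero hr, one_ne_zero⟩, fun t ht => ?_⟩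
    obtain ⟨e1, e2, e3⟩ := he t ht
    simp [Row1.toRow2, Row2.range, Row2.f, Row2.h, e1, e2, e3, f, Row1.h]
  · refine ⟨⟨eps_ne_zero hr, one_ne_zero⟩, fun t ht => ?_⟩
    obtain ⟨e1, e2, e3⟩ := he t ht
    simp [Row1.toRow2, Row2.range, Row2.f, Row2.h, e1, e2, e3, f, Row1.h]
  · refine ⟨eps_ne_zero hr, fun t ht => ?_⟩
    obtain ⟨e1, e2, e3⟩ := he t ht
    simp [Row1.toRow2, Row2.range, Row2.f, Row2.h, e1, e3, f, Row1.h]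

theorem Row1.Describes.isBasis {r : Row1} (h : r.Describes E) :
    IsBasisOfMaxAlgebra E r.basis := by
  have hT := hasDerivAt_id_of_g_one h.g_eq
  have hc := h.toRow2.classifying hT
  have hn := Row2.datum_ne h.toRow2.1
  have hf := h.toRow2.flat_iff hT
  have hg : ∀ p ∈ E.domain, E.g p.1 = 1 := fun p hp => h.g_eq p.1 hp
  rcases r with ⟨ε, ρ, l⟩ | ⟨ε⟩ | ⟨ε, l⟩ | ⟨ε⟩ | ⟨ε⟩
  · refine isBasis_pair hT (by simp [hf, Row1.toRow2]) hc hn fun p hp => ?_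
    simp only [Row1.toRow2, Row2.datum, affineField, hg p hp, id]
    refine Prod.ext ?_ (Prod.ext ?_ ?_) <;> simp only <;> ring
  · refine isBasis_pair hT (by simp [hf, Row1.toRow2]) hc hn fun p hp => ?_
    simp only [Row1.toRow2, Row2.datum, affineField, hg p hp, id]
    refine Prod.ext ?_ (Prod.ext ?_ ?_) <;> simp only <;> ring
  · refine isBasis_pair hT (by simp [hf, Row1.toRow2]) hc hn fun p hp => ?_
    simp only [Row1.toRow2, Row2.datum, affineField, hg p hp, id]
    refine Prod.ext ?_ (Prod.ext ?_ ?_) <;> simp only <;> ring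
  · refine isBasis_pair hT (by simp [hf, Row1.toRow2]) hc hn fun p hp => ?_
    simp only [Row1.toRow2, Row2.datum, affineField, hg p hp, id]
    refine Prod.ext ?_ (Prod.ext ?_ ?_) <;> simp only <;> ring
  · have hd := Row2.coeff_case5 h.toRow2
    refine isBasis_triple hT (μ := 0) (fun t ht => (hd t ht).2.2.1)
      (fun t ht => (hd t ht).2.1) (fun p hp => ?_) fun p hp => ?_
    · simp only [affineField, hg p hp, id]
      refine Prod.ext ?_ (Prod.ext ?_ ?_) <;> simp only <;> ring
    · simp only [affineField, hg p hp, id]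
      refine Prod.ext ?_ (Prod.ext ?_ ?_) <;> simp only <;> ring

/-! ### Normalisation of the parameters by equivalence transformations. -/

theorem exists_scaling {μ : ℝ} (hμ : μ ≠ 0) : ∃ δ : ℝ, 0 < δ ∧ (δ ^ 2 * μ = 1 ∨ δ ^ 2 * μ = -1) := by
  have hp : 0 < √|μ| := Real.sqrt_pos.2 (abs_pos.2 hμ)
  refine ⟨(√|μ|)⁻¹, inv_pos.2 hp, ?_⟩
  rw [inv_pow, Real.sq_sqrt (abs_nonneg μ)]
  rcases abs_cases μ with ⟨h, -⟩ | ⟨h, -⟩ <;> rw [h]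
  · exact .inl (inv_mul_cancel₀ hμ)
  · right
    field_simp

theorem exists_sign (E : Equation) {w : ℝ → ℝ} (hc : ContinuousOn w E.I)
    (hw : ∀ t ∈ E.I, w t ≠ 0) : ∃ s : ℝ, (s = 1 ∨ s = -1) ∧ ∀ t ∈ E.I, 0 < s * w t := by
  obtain ⟨t₀, ht₀⟩ := E.nonempty_I
  have hpre := E.ordConnected_I.isPreconnected
  rcases lt_or_gt_of_ne (hw t₀ ht₀) with h | h
  · refine ⟨-1, .inr rfl, fun t ht => ?_⟩
    by_contra! hn
    obtain ⟨c, hcI, h0⟩ := hpre.intermediate_value ht₀ ht hc ⟨h.le, by linarith⟩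
    exact hw c hcI h0
  · refine ⟨1, .inl rfl, fun t ht => ?_⟩
    by_contra! hn
    obtain ⟨c, hcI, h0⟩ := hpre.intermediate_value ht ht₀ hc ⟨by linarith, h.le⟩
    exact hw c hcI h0

theorem abs_eq_sign_mul {s w : ℝ} (hs : s = 1 ∨ s = -1) (h : 0 < s * w) : |w| = s * w := by
  rcases hs with rfl | rfl
  · rw [one_mul] at h ⊢
    exact abs_of_pos h
  · rw [neg_one_mul] at h ⊢
    exact abs_of_neg (by linarith)

theorem Row2.exists_row1_case1 {ε κ ρ μ₁ μ₂ μ₃ : ℝ}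
    (h : (case1 ε κ ρ μ₁ μ₂ μ₃).Describes E T) (hT : ∀ t ∈ E.I, HasDerivAt T (E.g t) t) :
    ∃ (E' : Equation) (r : Row1), GEquiv E E' ∧ r.Describes E' := by
  have hcoef := coeff_case1 h hT
  obtain ⟨hε, hμ, hne⟩ := h.1
  obtain ⟨δ, hδ, hδμ⟩ := exists_scaling hμ
  obtain ⟨s, hs, hsw⟩ := exists_sign E (w := fun t => ε * T t + κ)
    ((continuousOn_const.mul (contDiffOn_of_deriv_g hT).continuousOn).add continuousOn_const)
    fun t ht => (hcoef t ht).1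
  have hA : s * ε ≠ 0 := mul_ne_zero (eps_ne_zero hs) (eps_ne_zero hε)
  -- The new time is `s (ε T + κ) = |ε T + κ|`; `δ` normalises `μ₁` to `±1`, and the last argument
  -- removes `μ₃`.
  obtain ⟨E', hEE', hE'⟩ := exists_equiv_affine hT hA hδ.ne' (s * κ) (δ / (s * ε) * μ₃)
  refine ⟨E', .case1 (δ ^ 2 * μ₁) ρ (δ / (s * ε) * μ₂), hEE', ⟨hδμ, ?_⟩, fun y hy => ?_,
    fun y hy => ?_⟩
  · simpa [eps_ne_zero hs, eps_ne_zero hε, hδ.ne'] using hne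
  all_goals
    obtain ⟨t, ht, hy, e1, e2, e3⟩ := hE' y hy
    have hyw : y = s * (ε * T t + κ) := by rw [hy]; ring
    have hy0 : 0 < s * (ε * T t + κ) := hsw t ht
    obtain ⟨hw, c1, c2, -⟩ := hcoef t ht
  · rw [hyw]
    exact hy0
  · rw [← abs_rpow_eq_exp hw, abs_eq_sign_mul hs hy0, ← hyw] at c1 c2
    refine ⟨?_, e2, ?_⟩
    · rw [e1, c2, Row1.f]
      ring
    · rw [e3, c1, Row1.h]
      ring

theorem Row2.Describes.exists_row1 {r : Row2} (h : r.Describes E T)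
    (hT : ∀ t ∈ E.I, HasDerivAt T (E.g t) t) :
    ∃ (E' : Equation) (r : Row1), GEquiv E E' ∧ r.Describes E' := by
  rcases r with ⟨ε, κ, ρ, μ₁, μ₂, μ₃⟩ | ⟨ε, κ, μ₁, μ₂, μ₃⟩ | ⟨σ, μ₁, μ₂, μ₃⟩ | ⟨μ₁, μ₂, μ₃⟩ | ⟨μ₁, μ₃⟩
  · exact exists_row1_case1 h hT
  -- Without the logarithm this is Case 1 with `ρ = 2` and `μ₂ = 0`.
  · by_cases hμ₂ : μ₂ = 0
    · subst hμ₂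
      refine exists_row1_case1 (ε := ε) (κ := κ) (ρ := 2) (μ₁ := μ₁) (μ₂ := 0) (μ₃ := μ₃)
        ⟨⟨h.1.1, h.1.2, by simp⟩, fun t ht => ⟨(h.2 t ht).1, ?_, ?_⟩⟩ hT
      · rw [(h.2 t ht).2.1]
        simp only [Row2.f]
        ring
      · rw [(h.2 t ht).2.2]
        simp [Row2.h]
    have hcoef := coeff_case2 h hT
    obtain ⟨hε, hμ⟩ := h.1
    obtain ⟨s, hs, hsw⟩ := exists_sign E (w := fun t => ε * T t + κ)
      ((continuousOn_const.mul (contDiffOn_of_deriv_g hT).continuousOn).add continuousOn_const)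
      fun t ht => (hcoef t ht).1
    have hA : s * ε ≠ 0 := mul_ne_zero (eps_ne_zero hs) (eps_ne_zero hε)
    -- The scaling of `x` is used up in making the coefficient of the logarithm `1`, so `ε` stays an
    -- arbitrary nonzero constant.
    have hδ : s * ε / μ₂ ≠ 0 := div_ne_zero hA hμ₂
    obtain ⟨E', hEE', hE'⟩ := exists_equiv_affine hT hA hδ (s * κ) (μ₃ / μ₂)
    refine ⟨E', .case2 ((s * ε / μ₂) ^ 2 * μ₁), hEE', mul_ne_zero (pow_ne_zero 2 hδ) hμ,
      fun y hy => ?_, fun y hy => ?_⟩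
    all_goals
      obtain ⟨t, ht, hy, e1, e2, e3⟩ := hE' y hy
      have hyw : y = s * (ε * T t + κ) := by rw [hy]; ring
      have hy0 : 0 < s * (ε * T t + κ) := hsw t ht
      obtain ⟨hw, c1, c2, -⟩ := hcoef t ht
    · rw [hyw]
      exact hy0
    · rw [← Real.log_abs, abs_eq_sign_mul hs hy0, ← hyw] at c2
      rw [← sq_abs, abs_eq_sign_mul hs hy0, ← hyw] at c1
      refine ⟨?_, e2, ?_⟩
      · have h0 := eps_ne_zero hs
        have h0' := eps_ne_zero hε
        rw [e1, c2, Row1.f]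
        field_simp
        ring
      · rw [e3, c1, Row1.h]
        ring
  · have hcoef := coeff_case3 h hT
    obtain ⟨hμ, hσ⟩ := h.1
    obtain ⟨δ, hδ, hδμ⟩ := exists_scaling hμ
    obtain ⟨E', hEE', hE'⟩ := exists_equiv_affine hT hσ hδ.ne' 0 (δ / σ * μ₃)
    refine ⟨E', .case3 (δ ^ 2 * μ₁) (δ / σ * μ₂), hEE', hδμ, fun y _ => trivial, fun y hy => ?_⟩
    obtain ⟨t, ht, hy, e1, e2, e3⟩ := hE' y hy
    obtain ⟨c1, c2, -⟩ := hcoef t ht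
    refine ⟨?_, e2, ?_⟩
    · have : σ / 2 * T t = y / 2 := by rw [hy]; ring
      rw [e1, c2, this, Row1.f]
      ring
    · have : σ * T t = y := by rw [hy]; ring
      rw [e3, c1, this, Row1.h]
      ring
  · have hcoef := coeff_case4 h hT
    obtain ⟨hμ, hμ₂⟩ := h.1
    obtain ⟨δ₀, hδ₀, hδμ₀⟩ := exists_scaling hμ
    -- With new time `A T`, the new `f` is `(δ μ₂ / A) T` after removal of `μ₃`. It equals the new
    -- time when `A ^ 2 = δ μ₂`, which fixes the sign of `δ`.
    obtain ⟨δ, hδ, hδμ⟩ : ∃ δ : ℝ, 0 < δ * μ₂ ∧ (δ ^ 2 * μ₁ = 1 ∨ δ ^ 2 * μ₁ = -1) := by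
      rcases lt_or_gt_of_ne hμ₂ with hneg | hpos
      · exact ⟨-δ₀, by nlinarith, by rwa [neg_sq]⟩
      · exact ⟨δ₀, by positivity, hδμ₀⟩
    have hδ0 : δ ≠ 0 := left_ne_zero_of_mul hδ.ne'
    have hA : √(δ * μ₂) ≠ 0 := (Real.sqrt_pos.2 hδ).ne'
    have hA2 : √(δ * μ₂) ^ 2 = δ * μ₂ := Real.sq_sqrt hδ.le
    obtain ⟨E', hEE', hE'⟩ := exists_equiv_affine hT hA hδ0 0 (δ / √(δ * μ₂) * μ₃)
    refine ⟨E', .case4 (δ ^ 2 * μ₁), hEE', hδμ, fun y _ => trivial, fun y hy => ?_⟩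
    obtain ⟨t, ht, hy, e1, e2, e3⟩ := hE' y hy
    obtain ⟨c1, c2, -⟩ := hcoef t ht
    refine ⟨?_, e2, by rw [e3, c1, Row1.h]⟩
    rw [e1, c2, Row1.f, hy]
    field_simp
    linear_combination -T t * hA2
  · have hcoef := coeff_case5 h
    obtain ⟨δ, hδ, hδμ⟩ := exists_scaling h.1
    obtain ⟨E', hEE', hE'⟩ := exists_equiv_affine hT one_ne_zero hδ.ne' 0 (δ * μ₃)
    refine ⟨E', .case5 (δ ^ 2 * μ₁), hEE', hδμ, fun y _ => trivial, fun y hy => ?_⟩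
    obtain ⟨t, ht, hy, e1, e2, e3⟩ := hE' y hy
    obtain ⟨c1, c2, -⟩ := hcoef t ht
    refine ⟨?_, e2, by rw [e3, c1, Row1.h]⟩
    rw [e1, c2, Row1.f]
    ring

theorem hasExtension_iff_row1 (E : Equation) : HasExtension E ↔
    ∃ (E' : Equation) (r : Row1), GEquiv E E' ∧ r.Describes E' := by
  constructor
  · intro h
    obtain ⟨T, hT⟩ := E.exists_antiderivative
    obtain ⟨r, hr⟩ := (hasExtension_iff_row2 hT).1 h
    exact hr.exists_row1 hT
  · rintro ⟨E', r, ⟨Φ, hΦ⟩, hr⟩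
    have hc := hr.toRow2.classifying (hasDerivAt_id_of_g_one hr.g_eq)
    refine (hasExtension_iff (hΦ.hasDerivAt hr.g_eq)).2
      ⟨_, _, _, _, hΦ.classifying hr.g_eq hc, ?_⟩
    obtain ⟨h1, h3⟩ := mul_ne_zero_iff.1 Φ.δ_ne_zero
    exact (Row2.datum_ne hr.toRow2.1).imp_right fun h => mul_ne_zero (div_ne_zero h3 h1) h

/-! ### Inequivalence of the rows -/

theorem sign_eq_of_mul_pos {ε ε' : ℝ} (hε : ε = 1 ∨ ε = -1) (hε' : ε' = 1 ∨ ε' = -1) {x y : ℝ}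
    (hx : 0 < x) (hy : 0 < y) (h : ε' * y = ε * x) : ε = ε' := by
  rcases hε with rfl | rfl <;> rcases hε' with rfl | rfl <;> first | rfl | linarith

theorem Row1.flat_iff {r : Row1} (h : r.Describes E) : Flat E ↔ r.number = 5 := by
  rw [h.toRow2.flat_iff (hasDerivAt_id_of_g_one h.g_eq)]
  cases r <;> simp [Row1.toRow2, number]

/-- The generators modulo `∂_x` of equivalent equations correspond to each other. -/
theorem Row1.exists_multiple {r r' : Row1} (h : r.Describes E) (h' : r'.Describes E')
    {Φ : EquivTransformation E.I} (hΦ : Φ.Maps E') (hE : ¬ Flat E) :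
    ∃ m e : ℝ, (∀ t ∈ E.I, Φ.δ₃ / Φ.δ₁ * Φ.T t = t + e) ∧
      r'.toRow2.datum.1 = m * r.toRow2.datum.1 ∧ r'.toRow2.datum.2.1 = m * r.toRow2.datum.2.1 ∧
      (r'.toRow2.datum.2.1 * Φ.δ₄ + r'.toRow2.datum.2.2.1) / Φ.δ₃ = m * r.toRow2.datum.2.2.1 ∧
      Φ.δ₃ / Φ.δ₁ * r'.toRow2.datum.2.2.2
        + (r'.toRow2.datum.1 - r'.toRow2.datum.2.1) * e = m * r.toRow2.datum.2.2.2 := by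
  have hT := hasDerivAt_id_of_g_one h.g_eq
  -- Both functions are antiderivatives of `g = 1`, so they differ by a constant.
  obtain ⟨e, he⟩ := is_const_on_I E (F := fun t => Φ.δ₃ / Φ.δ₁ * Φ.T t - id t) fun t ht =>
    ((hΦ.hasDerivAt h'.g_eq t ht).sub (hT t ht)).congr_deriv (sub_self _)
  have he' : ∀ t ∈ E.I, Φ.δ₃ / Φ.δ₁ * Φ.T t = id t + e := fun t ht => by
    linear_combination he t ht
  have hc := h'.toRow2.classifying (hasDerivAt_id_of_g_one h'.g_eq)
  obtain ⟨m, hm⟩ := (h.toRow2.classifying hT).exists_multiple hT hE (Row2.datum_ne h.toRow2.1)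
    ((hΦ.classifying h'.g_eq hc).shift he')
  exact ⟨m, e, he', hm⟩

theorem Row1.number_eq {r r' : Row1} (h : r.Describes E) (h' : r'.Describes E')
    {Φ : EquivTransformation E.I} (hΦ : Φ.Maps E') : r.number = r'.number := by
  by_cases hE : Flat E
  · rw [(flat_iff h).1 hE, (flat_iff h').1 (hΦ.flat_iff.1 hE)]
  have h5 : r.number ≠ 5 := fun h5 => hE ((flat_iff h).2 h5)
  have h5' : r'.number ≠ 5 := fun h5 => hE (hΦ.flat_iff.2 ((flat_iff h').2 h5))
  obtain ⟨-, h3⟩ := mul_ne_zero_iff.1 Φ.δ_ne_zero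
  obtain ⟨m, e, -, e1, e2, e3, -⟩ := exists_multiple h h' hΦ hE
  rw [div_eq_iff h3] at e3
  rcases r with ⟨ε, ρ, l⟩ | ⟨ε⟩ | ⟨ε, l⟩ | ⟨ε⟩ | ⟨ε⟩ <;>
  rcases r' with ⟨ε', ρ', l'⟩ | ⟨ε'⟩ | ⟨ε', l'⟩ | ⟨ε'⟩ | ⟨ε'⟩ <;>
  simp only [number, ne_eq, not_true_eq_false] at h5 h5' ⊢ <;>
  simp only [Row1.toRow2, Row2.datum] at e1 e2 e3 <;>
  first
  | linarith
  | skip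
  -- The pairs of cases left, because products of unknowns occur, are (1, 3), (2, 1) and (2, 4). The
  -- middle one would force `δ₃ = 0`.
  · obtain rfl : m = 0 := by linarith
    linarith
  · obtain rfl : ρ' = 2 := by linarith
    obtain rfl : m = 2 := by linarith
    exact absurd (by linarith) h3
  · obtain rfl : m = 0 := by linarith
    linarith

theorem Row1.eps_eq {r r' : Row1} (h : r.Describes E) (h' : r'.Describes E')
    {Φ : EquivTransformation E.I} (hΦ : Φ.Maps E') : r.eps = r'.eps := by
  have hn := number_eq h h' hΦ
  obtain ⟨h1, h3⟩ := mul_ne_zero_iff.1 Φ.δ_ne_zero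
  obtain ⟨t, ht⟩ := E.nonempty_I
  have hh := (hΦ.2 t ht).2.2
  rw [(h.2.2 t ht).2.2, (h'.2.2 _ (hΦ.mem ht)).2.2] at hh
  have hI := h.2.1 ht
  have hI' := h'.2.1 (hΦ.mem ht)
  have hδ : 0 < Φ.δ₁ ^ 2 := by positivity
  rcases r with ⟨ε, ρ, l⟩ | ⟨ε⟩ | ⟨ε, l⟩ | ⟨ε⟩ | ⟨ε⟩ <;>
  rcases r' with ⟨ε', ρ', l'⟩ | ⟨ε'⟩ | ⟨ε', l'⟩ | ⟨ε'⟩ | ⟨ε'⟩ <;>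
  first
  | (exfalso; simp [number] at hn; done)
  | skip
  · exact sign_eq_of_mul_pos h.1.1 h'.1.1 (mul_pos hδ (Real.rpow_pos_of_pos hI ρ))
      (Real.rpow_pos_of_pos hI' ρ') (hh.trans (mul_left_comm _ _ _))
  -- In Case 2 the generators must coincide, so `δ₃ = 1` and the new time is `δ₁ t`. The factor `δ₁
  -- ^ 2` in `h` is then absorbed by `t ^ 2`.
  · have hE : ¬ Flat E := fun hE => by simpa [number] using (flat_iff h).1 hE
    obtain ⟨m, e, he, e1, e2, e3, e4⟩ := exists_multiple h h' hΦ hE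
    simp only [Row1.toRow2, Row2.datum] at e1 e2 e3 e4
    have hm : m = 1 := by linarith
    subst hm
    have he0 : e = 0 := by linarith
    have hδ₃ : Φ.δ₃ = 1 := by
      field_simp at e3
      linarith
    have hTt := he t ht
    rw [hδ₃, he0] at hTt
    have hTt' : Φ.T t = Φ.δ₁ * t := by
      field_simp at hTt
      linarith
    have ht0 : (0 : ℝ) < t := hI
    simp only [Row1.h, hTt'] at hh
    refine mul_right_cancel₀ (mul_pos hδ (pow_pos ht0 2)).ne' ?_
    simp only [eps]
    linear_combination -hh
  · exact sign_eq_of_mul_pos h.1 h'.1 (mul_pos hδ (Real.exp_pos _)) (Real.exp_pos _)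
      (hh.trans (mul_left_comm _ _ _))
  · exact sign_eq_of_mul_pos h.1 h'.1 hδ one_pos ((mul_one _).trans (hh.trans (mul_comm _ _)))
  · exact sign_eq_of_mul_pos h.1 h'.1 hδ one_pos ((mul_one _).trans (hh.trans (mul_comm _ _)))

/-! ### The kernel -/

theorem isLieSymmetry_smul_partialX (E : Equation) {v : VectorField} {c : ℝ}
    (hv : Set.EqOn v (c • partialX) E.domain) : IsLieSymmetry E v := by
  obtain ⟨T, hT⟩ := E.exists_antiderivative
  refine (isLieSymmetry_iff_classifying hT v).2
    ⟨c, 0, 0, 0, 0, fun p hp => (hv hp).trans ?_, Classifying.zero⟩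
  simp [affineField, partialX]

/-- The equation `u_t + t u_x + u u_x + e^t u_{xxt} = 0` over `I`. -/
noncomputable def rigidEquation {I : Set ℝ} (ho : IsOpen I) (hc : I.OrdConnected)
    (hn : I.Nonempty) : Equation where
  I := I
  f := id
  g := fun _ => 1
  h := Real.exp
  isOpen_I := ho
  ordConnected_I := hc
  nonempty_I := hn
  smooth_f := contDiffOn_id
  smooth_g := contDiffOn_const
  smooth_h := Real.contDiff_exp.contDiffOn
  g_ne_zero := fun _ _ => one_ne_zero
  h_ne_zero := fun t _ => Real.exp_ne_zero t

/-- Since `h' = h` and `f / g = t`, the conditions read `(a - α) t + k = 2 a = α t - b`, and affine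
functions that agree on an interval have equal coefficients. -/
theorem isLieSymmetry_rigidEquation {I : Set ℝ} (ho : IsOpen I) (hc : I.OrdConnected)
    (hn : I.Nonempty) {v : VectorField} (h : IsLieSymmetry (rigidEquation ho hc hn) v) :
    ∃ c : ℝ, Set.EqOn v (c • partialX) (dom I) := by
  set E := rigidEquation ho hc hn with hE
  have hT : ∀ t ∈ E.I, HasDerivAt id (E.g t) t := hasDerivAt_id_of_g_one fun _ _ => rfl
  obtain ⟨c, a, α, b, k, hv, hcl⟩ := (isLieSymmetry_iff_classifying hT v).1 h
  have hr : E.ratio = id := by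
    funext t
    simp [Equation.ratio, hE, rigidEquation]
  have e : ∀ t ∈ E.I, (a - α) * t + k = 2 * a ∧ (a - α) * t + k = α * t - b := by
    intro t ht
    obtain ⟨e1, e2⟩ := hcl t ht
    rw [hr] at e2
    simp only [hE, rigidEquation, Real.deriv_exp, deriv_id, id, mul_one, one_mul] at e1 e2
    exact ⟨mul_right_cancel₀ (Real.exp_ne_zero t) e1, e2⟩
  obtain ⟨h1, h2⟩ := eq_zero_of_affine hT (p := a - α) (q := k - 2 * a) fun t ht => by
    simp only [id]
    linear_combination (e t ht).1
  obtain ⟨h3, h4⟩ := eq_zero_of_affine hT (p := α) (q := -b - 2 * a) fun t ht => by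
    simp only [id]
    linear_combination (e t ht).1 - (e t ht).2
  have ha : a = 0 := by linear_combination h1 + h3
  have hb : b = 0 := by linear_combination -h4 - 2 * ha
  have hk : k = 0 := by linear_combination h2 + 2 * ha
  subst ha h3 hb hk
  exact ⟨c, fun p hp => (hv hp).trans (by simp [affineField, partialX])⟩

end List

end BBM

theorem corollary3 :
    -- the kernel of the maximal Lie invariance algebras is spanned by `∂_x`
    (∀ I : Set ℝ, IsOpen I → I.OrdConnected → I.Nonempty → ∀ v : BBM.VectorField,
      (∀ E : BBM.Equation, E.I = I → BBM.IsLieSymmetry E v) ↔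
        ∃ c : ℝ, Set.EqOn v (c • BBM.partialX) {p | p.1 ∈ I}) ∧
    -- every equation is equivalent to one with `g = 1`
    (∀ E : BBM.Equation, ∃ E' : BBM.Equation, BBM.GEquiv E E' ∧ ∀ t ∈ E'.I, E'.g t = 1) ∧
    -- the list up to equivalence: the maximal Lie invariance algebras
    (∀ (r : BBM.Row1) (E : BBM.Equation), r.Describes E → BBM.IsBasisOfMaxAlgebra E r.basis) ∧
    -- the list up to equivalence: it exhausts the Lie symmetry extensions
    (∀ E : BBM.Equation, BBM.HasExtension E ↔
      ∃ (E' : BBM.Equation) (r : BBM.Row1), BBM.GEquiv E E' ∧ r.Describes E') ∧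
    -- the list up to equivalence: different cases, or values of `ε`, are inequivalent
    (∀ (r r' : BBM.Row1) (E E' : BBM.Equation), r.Describes E → r'.Describes E' →
      BBM.GEquiv E E' → r.number = r'.number ∧ r.eps = r'.eps) ∧
    -- the list without equivalence: the maximal Lie invariance algebras, and exhaustiveness
    (∀ (E : BBM.Equation) (T : ℝ → ℝ), (∀ t ∈ E.I, HasDerivAt T (E.g t) t) →
      (∀ r : BBM.Row2, r.Describes E T → BBM.IsBasisOfMaxAlgebra E (r.basis E.g T)) ∧
      (BBM.HasExtension E ↔ ∃ r : BBM.Row2, r.Describes E T)) := by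
  refine ⟨fun I ho hc hn v => ⟨fun h => ?_, ?_⟩, fun E => ?_, fun r E h => h.isBasis,
    BBM.hasExtension_iff_row1, ?_, fun E T hT => ⟨fun r h => h.isBasis hT,
    BBM.hasExtension_iff_row2 hT⟩⟩
  · exact BBM.isLieSymmetry_rigidEquation ho hc hn (h _ rfl)
  · rintro ⟨c, hv⟩ E rfl
    exact BBM.isLieSymmetry_smul_partialX E hv
  · obtain ⟨T, hT⟩ := E.exists_antiderivative
    obtain ⟨E', h, hE'⟩ := BBM.exists_equiv_affine hT one_ne_zero one_ne_zero 0 0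
    refine ⟨E', h, fun y hy => ?_⟩
    obtain ⟨t, -, -, -, hg, -⟩ := hE' y hy
    exact hg
  · rintro r r' E E' h h' ⟨Φ, hΦ⟩
    exact ⟨BBM.Row1.number_eq h h' hΦ, BBM.Row1.eps_eq h h' hΦ⟩
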